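/- Let $d\ge 0$ and $r_0,r_1,r_2,r_3\ge 0$ be integers, and let $S=\mathbb{C}[x_0,x_1,x_2;y_0,y_1,y_2,y_3]$ carry the bigrading with $\deg x_k=(1,0)$ for $k\in\{0,1,2\}$ and $\deg y_j=(-r_j,1)$ for $j\in\{0,1,2,3\}$. For $m,n\in\mathbb{Z}$ let $S(m,n)$ be the finite-dimensional complex vector space of homogeneous polynomials of bidegree $(m,n)$ in $S$, and put $t=4d-3+r_0+r_1+r_2+r_3$. Then for general polynomials $f\in S(d,2)$ and $g\in S(t-d,2)$, that is, for all pairs $(f,g)$ in some nonempty Zariski open subset of the vector space $S(d,2)\oplus S(t-d,2)$, the ideal in $S$ generated by the eight polynomials \[ \frac{\partial f}{\partial x_0},\quad \frac{\partial f}{\partial x_1},\quad \frac{\partial f}{\partial x_2},\quad \frac{\partial f}{\partial y_0},\quad \frac{\partial f}{\partial y_1},\quad \frac{\partial f}{\partial y_2},\quad \frac{\partial f}{\partial y_3},\quad g \] contains all polynomials in $S(t,4)$. -/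

import Mathlib

open MvPolynomial

namespace BigradedRing

/-- The polynomial ring `S = ℂ[x₀, x₁, x₂; y₀, y₁, y₂, y₃]`: the variable `x_k` is
`X (Sum.inl k)` and the variable `y_j` is `X (Sum.inr j)`. -/
abbrev S : Type := MvPolynomial (Fin 3 ⊕ Fin 4) ℂ

/-- The bidegrees of the variables: `deg x_k = (1, 0)` and `deg y_j = (-r_j, 1)`. -/
def bidegree (r : Fin 4 → ℕ) : Fin 3 ⊕ Fin 4 → ℤ × ℤ :=
  Sum.elim (fun _ => (1, 0)) (fun j => (-(r j : ℤ), 1))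

/-- `S(m, n)`, the complex vector space of homogeneous polynomials of bidegree `(m, n)`. -/
noncomputable def homogeneousPart (r : Fin 4 → ℕ) (m n : ℤ) : Submodule ℂ S :=
  weightedHomogeneousSubmodule ℂ (bidegree r) (m, n)

/-- The integer `t = 4 d - 3 + r₀ + r₁ + r₂ + r₃`. -/
def t (d : ℕ) (r : Fin 4 → ℕ) : ℤ := 4 * (d : ℤ) - 3 + ∑ j, (r j : ℤ)

/-- The ideal of `S` generated by the seven partial derivatives of `f` together with `g`. -/
noncomputable def jacobianIdealWith (f g : S) : Ideal S :=
  Ideal.span (Set.range (fun i => pderiv i f) ∪ {g})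

end BigradedRing

namespace Zariski

/-- The algebra of polynomial functions on a complex vector space `V`, i.e. the algebra of
functions generated by the linear forms. -/
def polynomialFunctions (V : Type*) [AddCommGroup V] [Module ℂ V] : Subalgebra ℂ (V → ℂ) :=
  Algebra.adjoin ℂ (Set.range (fun φ : Module.Dual ℂ V => (φ : V → ℂ)))

/-- A subset of `V` is Zariski open if its complement is the common zero locus of a set of
polynomial functions. -/
def IsZariskiOpen {V : Type*} [AddCommGroup V] [Module ℂ V] (U : Set V) : Prop :=
  ∃ T : Set (V → ℂ), T ⊆ polynomialFunctions V ∧ Uᶜ = {v | ∀ p ∈ T, p v = 0}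

/-- A property holds for a general element of `V` if it holds for all elements of some nonempty
Zariski open subset of `V`. -/
def ForGeneral {V : Type*} [AddCommGroup V] [Module ℂ V] (P : V → Prop) : Prop :=
  ∃ U : Set V, IsZariskiOpen U ∧ U.Nonempty ∧ ∀ v ∈ U, P v

end Zariski

/-!
It suffices to find one pair `(f, g)` for which the ideal `J` of the statement contains `S(t, 4)`:
a determinant is then nonzero at this pair, and its nonvanishing implies the claim for other pairs
(`Zariski.forGeneral_span_of_exists`).

Put `e_i = d + 2 r_i` and `2 N = ∑ e_i`. The pair is diagonal: `f = ∑ a_i y_i ^ 2`, where `a_i` is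
a product of `e_i` linear forms `x₀ + c x₁ + c² x₂`, and `g = ∑ x₂ ^ (N + e_i - 3) y_i ^ 2`,
summed over the `i` with `e_i ≥ 2`. The lines are tangents of a conic, so that the intersection
point of two lines is a symmetric function of their parameters. All lines are different, and each
has one of four colours, the index `i`.

Since `J` contains `a_i y_i`, a form in `x₀, x₁, x₂` times a monomial `y_i y_j ⋯` matters only
through its values at the intersection points of the lines of colours `i` and `j`
(`exists_eq_lines_lines`). This settles the monomials with three different indices
(`mem_of_distinct`), and with the derivatives of `f` along the lines it settles `y_i ^ 3 y_j`
(`mem_of_cube`).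

The main point is `y_i ^ 2 y_j ^ 2` (`mem_of_squares`). A linear form on `S` which vanishes on `J`
gives a symmetric function `φ` on pairs of parameters, zero on pairs of equal colour, and the
derivatives of `f` in the directions of a line `c` give `∑ m, (m - c) m ^ k φ c m = 0` for `k ≤
N`. By Lagrange interpolation `φ` is then, up to nonzero factors, the restriction of a bivariate
polynomial of degree less than `N - 2` in each variable, which vanishes on the pairs of equal
colour (`eq_zero_of_symmetric_of_moments`). For a good choice of the parameters there is no such
polynomial but zero (`exists_monochromaticDetermining`): by induction on the degree, points are
added until the polynomial is forced to be divisible by the equations of two lines, where two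
points of different colours are first put at the same place and then moved apart.

For `y_i ^ 4` (`mem_of_fourth_power`), multiples of `g` correct the values at the double points of
the lines of colour `i`; what remains is in the ideal generated by the products of all lines of
colour `i` but one, and the derivatives of `f` treat it.
-/

/-! ### Points determining polynomials of small bidegree -/

namespace BivariateInterpolation

open Polynomial Polynomial.Bivariate

/-- A bivariate polynomial has bidegree less than `k` if it has degree less than `k` in each of
its two variables. -/
def BidegreeLT (k : ℕ) (F : ℂ[X][Y]) : Prop :=
  F.degree < k ∧ ∀ n, (F.coeff n).degree < k

/-- The points `c z`, for `z ∈ Λ`, coloured by `col`, determine bidegree `< k`: a bivariate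
polynomial of bidegree less than `k` which vanishes at all pairs `(c z, c w)` of equally coloured
points with `z ≠ w` is zero. -/
def MonochromaticDetermining {α κ : Type*} (col : α → κ) (Λ : Finset α) (c : α → ℂ) (k : ℕ) :
    Prop :=
  ∀ F : ℂ[X][Y], BidegreeLT k F →
    (∀ z ∈ Λ, ∀ w ∈ Λ, z ≠ w → col z = col w → F.evalEval (c z) (c w) = 0) → F = 0

lemma BidegreeLT.eq_zero {F : ℂ[X][Y]} (hF : BidegreeLT 0 F) : F = 0 := by
  have h := hF.1
  simpa [Polynomial.degree_eq_bot] using h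

/-- The restriction of a bivariate polynomial to the line where the first variable is `a`. -/
lemma eval_map_evalRingHom (F : ℂ[X][Y]) (a t : ℂ) :
    (F.map (Polynomial.evalRingHom a)).eval t = F.evalEval a t := by
  rw [← Polynomial.eval₂_evalRingHom, Polynomial.eval_map]

lemma degree_mul_C_lt {p : ℂ[X]} {k : ℕ} (hp : p.degree < k) (a : ℂ) :
    (p * Polynomial.C a).degree < k := by
  refine lt_of_le_of_lt ?_ hp
  refine (Polynomial.degree_mul_le _ _).trans ?_
  calc p.degree + (Polynomial.C a).degree ≤ p.degree + 0 := by
        gcongr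
        exact Polynomial.degree_C_le
    _ = p.degree := add_zero _

lemma BidegreeLT.degree_eval_C {k : ℕ} {F : ℂ[X][Y]} (hF : BidegreeLT k F) (a : ℂ) :
    (F.eval (Polynomial.C a)).degree < k := by
  rw [Polynomial.eval_eq_sum]
  refine (Polynomial.degree_sum_le _ _).trans_lt ?_
  rw [Finset.sup_lt_iff (by exact WithBot.bot_lt_coe k)]
  intro n _
  have h := degree_mul_C_lt (hF.2 n) (a ^ n)
  rwa [Polynomial.C_pow] at h

/-- A bivariate polynomial vanishing on the two lines on which one of the variables is `a` is
divisible by the equations of both lines. -/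
lemma BidegreeLT.exists_eq_mul {k : ℕ} {F : ℂ[X][Y]} (hF : BidegreeLT (k + 1) F) {a : ℂ}
    (h₁ : F.map (Polynomial.evalRingHom a) = 0) (h₂ : F.eval (Polynomial.C a) = 0) :
    ∃ F' : ℂ[X][Y], BidegreeLT k F' ∧
      F = (Polynomial.X - Polynomial.C (Polynomial.C a)) *
        (Polynomial.C (Polynomial.X - Polynomial.C a) * F') := by
  obtain ⟨G, rfl⟩ := Polynomial.dvd_iff_isRoot.mpr h₂
  have hG : G.map (Polynomial.evalRingHom a) = 0 := by
    rw [Polynomial.map_mul] at h₁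
    refine (mul_eq_zero.mp h₁).resolve_left ?_
    simp [Polynomial.X_sub_C_ne_zero]
  have hdvd : Polynomial.C (Polynomial.X - Polynomial.C a) ∣ G := by
    rw [Polynomial.C_dvd_iff_dvd_coeff]
    intro n
    rw [Polynomial.dvd_iff_isRoot]
    have := congrArg (fun p => p.coeff n) hG
    simpa using this
  obtain ⟨F', rfl⟩ := hdvd
  refine ⟨F', ⟨?_, ?_⟩, rfl⟩
  · have h := hF.1
    rcases eq_or_ne F' 0 with rfl | h0
    · simp
    rw [Polynomial.degree_mul, Polynomial.degree_X_sub_C, Polynomial.degree_C_mul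
      (Polynomial.X_sub_C_ne_zero a), Polynomial.degree_eq_natDegree h0] at h
    rw [Polynomial.degree_eq_natDegree h0]
    norm_cast at h ⊢
    omega
  · -- The top coefficient in the second variable is handled by descending induction: every
    -- coefficient of `F'` is a combination of coefficients of `F` of higher index.
    have key : ∀ m n, F'.natDegree < n + m → (F'.coeff n).degree < k := by
      intro m
      induction m with
      | zero =>
        intro n hn
        rw [Polynomial.coeff_eq_zero_of_natDegree_lt (by omega)]
        simp
      | succ m ih =>
        intro n hn
        have h1 := ih (n + 1) (by omega)
        have h2 := hF.2 (n + 1)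
        rw [sub_mul, Polynomial.coeff_sub, Polynomial.coeff_X_mul, Polynomial.coeff_C_mul,
          Polynomial.coeff_C_mul, Polynomial.coeff_C_mul] at h2
        have h3 : ∀ q : ℂ[X],
            ((Polynomial.X - Polynomial.C a) * q).degree < ((k + 1 : ℕ) : WithBot ℕ) ↔
              q.degree < k := by
          intro q
          rcases eq_or_ne q 0 with rfl | h0
          · simp
          rw [Polynomial.degree_mul, Polynomial.degree_X_sub_C, Polynomial.degree_eq_natDegree h0]
          norm_cast
          omega
        rw [← h3] at h1 ⊢
        have h4 : (Polynomial.X - Polynomial.C a) * F'.coeff n =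
            ((Polynomial.X - Polynomial.C a) * F'.coeff n -
              Polynomial.C a * ((Polynomial.X - Polynomial.C a) * F'.coeff (n + 1))) +
            Polynomial.C a * ((Polynomial.X - Polynomial.C a) * F'.coeff (n + 1)) := by ring
        rw [h4]
        refine (Polynomial.degree_add_le _ _).trans_lt (max_lt h2 ?_)
        rw [mul_comm (Polynomial.C a)]
        exact degree_mul_C_lt h1 a
    intro n
    exact key (F'.natDegree + 1) n (by omega)

/-- A bivariate polynomial of bidegree `< k` is the sum of its monomials. -/
lemma BidegreeLT.evalEval_eq_sum {k : ℕ} {F : ℂ[X][Y]} (hF : BidegreeLT k F) (s t : ℂ) :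
    F.evalEval s t =
      ∑ p : Fin k × Fin k, (F.coeff p.2).coeff p.1 * (s ^ (p.1 : ℕ) * t ^ (p.2 : ℕ)) := by
  have h1 : F.eval (Polynomial.C t) =
      ∑ n : Fin k, F.coeff n * Polynomial.C t ^ (n : ℕ) := by
    rw [Polynomial.eval_eq_sum, ← Polynomial.sum_fin _ (by simp) hF.1]
  rw [Polynomial.evalEval, h1, Polynomial.eval_finsetSum, Fintype.sum_prod_type_right]
  refine Finset.sum_congr rfl fun n _ => ?_
  rw [Polynomial.eval_mul, Polynomial.eval_pow, Polynomial.eval_C, Polynomial.eval_eq_sum,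
    ← Polynomial.sum_fin _ (by simp) (hF.2 n), Finset.sum_mul]
  exact Finset.sum_congr rfl fun m _ => by ring

/-- Determination of bidegree `< k` is linear independence of the monomials of bidegree `< k`,
as functions on the monochromatic pairs of points. -/
lemma monochromaticDetermining_iff {α κ : Type*} [Fintype α] [DecidableEq α] [DecidableEq κ]
    (col : α → κ) (Λ : Finset α) (c : α → ℂ) (k : ℕ) :
    MonochromaticDetermining col Λ c k ↔
      LinearIndependent ℂ (fun (p : Fin k × Fin k) (q : α × α) =>
        if q.1 ∈ Λ ∧ q.2 ∈ Λ ∧ q.1 ≠ q.2 ∧ col q.1 = col q.2 then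
          c q.1 ^ (p.1 : ℕ) * c q.2 ^ (p.2 : ℕ) else 0) := by
  rw [Fintype.linearIndependent_iff]
  constructor
  · intro h g hg
    set F : ℂ[X][Y] := ∑ p : Fin k × Fin k,
      Polynomial.monomial (p.2 : ℕ) (Polynomial.monomial (p.1 : ℕ) (g p)) with hFdef
    have hcoeff : ∀ n, F.coeff n = ∑ p : Fin k × Fin k,
        if (p.2 : ℕ) = n then Polynomial.monomial (p.1 : ℕ) (g p) else 0 := by
      intro n
      simp [hFdef, Polynomial.finsetSum_coeff, Polynomial.coeff_monomial]
    have hF : BidegreeLT k F := by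
      constructor
      · rw [Polynomial.degree_lt_iff_coeff_zero]
        intro n hn
        rw [hcoeff]
        exact Finset.sum_eq_zero fun p _ => if_neg (by have := p.2.2; omega)
      · intro n
        rw [Polynomial.degree_lt_iff_coeff_zero]
        intro m hm
        rw [hcoeff, Polynomial.finsetSum_coeff]
        refine Finset.sum_eq_zero fun p _ => ?_
        split_ifs
        · exact Polynomial.coeff_monomial_of_ne _ (by have := p.1.2; omega)
        · simp
    have hc : ∀ p : Fin k × Fin k, (F.coeff p.2).coeff p.1 = g p := by
      intro p
      rw [hcoeff, Polynomial.finsetSum_coeff, Finset.sum_eq_single p]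
      · simp
      · intro q _ hq
        split_ifs with h2
        · refine Polynomial.coeff_monomial_of_ne _ fun h1 => hq ?_
          exact Prod.ext (Fin.ext h1.symm) (Fin.ext h2)
        · simp
      · simp
    have h0 := h F hF (by
      intro z hz w hw hzw hcol
      have := congrFun hg (z, w)
      rw [hF.evalEval_eq_sum]
      simpa [hc, hz, hw, hzw, hcol] using this)
    intro p
    rw [← hc p, h0]
    simp
  · intro h F hF hv
    have h0 := h (fun p => (F.coeff p.2).coeff p.1) (by
      funext q
      by_cases hq : q.1 ∈ Λ ∧ q.2 ∈ Λ ∧ q.1 ≠ q.2 ∧ col q.1 = col q.2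
      · have := hv q.1 hq.1 q.2 hq.2.1 hq.2.2.1 hq.2.2.2
        rw [hF.evalEval_eq_sum] at this
        simpa [hq] using this
      · simp [hq])
    ext n m
    by_cases hn : n < k
    · by_cases hm : m < k
      · simpa using h0 (⟨m, hm⟩, ⟨n, hn⟩)
      · rw [Polynomial.coeff_eq_zero_of_degree_lt ((hF.2 n).trans_le
          (by exact_mod_cast not_lt.mp hm))]
        simp
    · rw [Polynomial.coeff_eq_zero_of_degree_lt (hF.1.trans_le (by exact_mod_cast not_lt.mp hn))]
      simp

/-- Determination of bidegree `< k` is preserved by small changes of one of the points. -/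
lemma MonochromaticDetermining.eventually_update {α κ : Type*} [Fintype α] [DecidableEq α]
    {col : α → κ} {Λ : Finset α} {c : α → ℂ} {k : ℕ}
    (h : MonochromaticDetermining col Λ c k) (z : α) :
    ∀ᶠ x in nhds (c z), MonochromaticDetermining col Λ (Function.update c z x) k := by
  classical
  have hc : Continuous fun x : ℂ => (fun (p : Fin k × Fin k) (q : α × α) =>
        if q.1 ∈ Λ ∧ q.2 ∈ Λ ∧ q.1 ≠ q.2 ∧ col q.1 = col q.2 then
          (Function.update c z x) q.1 ^ (p.1 : ℕ) * (Function.update c z x) q.2 ^ (p.2 : ℕ)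
          else (0 : ℂ)) := by
    refine continuous_pi fun p => continuous_pi fun q => ?_
    split_ifs
    · have h1 : ∀ w, Continuous fun x : ℂ => (Function.update c z x) w := by
        intro w
        rcases eq_or_ne w z with rfl | hw
        · simpa using continuous_id'
        · simpa [Function.update_of_ne hw] using continuous_const
      exact ((h1 _).pow _).mul ((h1 _).pow _)
    · exact continuous_const
  have ho := (isOpen_setOfPred_linearIndependent (𝕜 := ℂ) (E := α × α → ℂ)
    (ι := Fin k × Fin k)).preimage hc
  have hmem := ho.mem_nhds (x := c z) (by
    have := (monochromaticDetermining_iff col Λ c k).mp h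
    simpa [Function.update_eq_self] using this)
  filter_upwards [hmem] with x hx
  rw [monochromaticDetermining_iff]
  exact hx

/-- A bivariate polynomial of bidegree `< k + 1` which vanishes at `(a, b)` and at `(b, a)` for
more than `k` values of `b` is divisible by the equations of the two lines on which one of the
variables is `a`. -/
lemma BidegreeLT.exists_eq_mul_of_card {k : ℕ} {F : ℂ[X][Y]} (hF : BidegreeLT (k + 1) F) {a : ℂ}
    (T : Finset ℂ) (hT : k + 1 ≤ T.card) (h₁ : ∀ b ∈ T, F.evalEval a b = 0)
    (h₂ : ∀ b ∈ T, F.evalEval b a = 0) :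
    ∃ F' : ℂ[X][Y], BidegreeLT k F' ∧
      F = (Polynomial.X - Polynomial.C (Polynomial.C a)) *
        (Polynomial.C (Polynomial.X - Polynomial.C a) * F') := by
  refine hF.exists_eq_mul ?_ ?_
  · refine Polynomial.eq_zero_of_degree_lt_of_eval_finset_eq_zero T ?_ ?_
    · refine lt_of_le_of_lt Polynomial.degree_map_le (hF.1.trans_le ?_)
      exact_mod_cast hT
    · intro b hb
      rw [eval_map_evalRingHom]
      exact h₁ b hb
  · refine Polynomial.eq_zero_of_degree_lt_of_eval_finset_eq_zero T ?_ h₂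
    exact (hF.degree_eval_C a).trans_le (by exact_mod_cast hT)

lemma MonochromaticDetermining.congr {α κ : Type*} {col : α → κ} {Λ : Finset α} {c c' : α → ℂ}
    {k : ℕ} (h : MonochromaticDetermining col Λ c k) (hc : ∀ z ∈ Λ, c' z = c z) :
    MonochromaticDetermining col Λ c' k := by
  intro F hF hv
  refine h F hF fun z hz w hw hzw hcol => ?_
  rw [← hc z hz, ← hc w hw]
  exact hv z hz w hw hzw hcol

/-- The inductive step: points `z ∈ R` with the common value `a` are added to a configuration
`Λ \ R`, in such a way that the line through `a` contains more than `k` monochromatic pairs. -/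
lemma MonochromaticDetermining.of_sdiff {α κ : Type*} [DecidableEq α]
    {col : α → κ} {Λ R : Finset α} {c : α → ℂ} {k : ℕ} {a : ℂ}
    (h : MonochromaticDetermining col (Λ \ R) c k) (hR : ∀ z ∈ R, c z = a)
    (ha : ∀ z ∈ Λ \ R, c z ≠ a) (T : Finset ℂ) (hT : k + 1 ≤ T.card)
    (hTR : ∀ b ∈ T, ∃ w ∈ Λ, ∃ z ∈ R, z ∈ Λ ∧ z ≠ w ∧ col z = col w ∧ c w = b) :
    MonochromaticDetermining col Λ c (k + 1) := by
  intro F hF hv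
  obtain ⟨F', hF', rfl⟩ := hF.exists_eq_mul_of_card (a := a) T hT
    (by
      intro b hb
      obtain ⟨w, hw, z, hz, hzΛ, hzw, hcol, rfl⟩ := hTR b hb
      rw [← hR z hz]
      exact hv z hzΛ w hw hzw hcol)
    (by
      intro b hb
      obtain ⟨w, hw, z, hz, hzΛ, hzw, hcol, rfl⟩ := hTR b hb
      rw [← hR z hz]
      exact hv w hw z hzΛ hzw.symm hcol.symm)
  rw [h F' hF', mul_zero, mul_zero]
  intro z hz w hw hzw hcol
  have := hv z (Finset.mem_sdiff.mp hz).1 w (Finset.mem_sdiff.mp hw).1 hzw hcol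
  have h1 := sub_ne_zero.mpr (ha z hz)
  have h2 := sub_ne_zero.mpr (ha w hw)
  rw [Polynomial.evalEval_mul, Polynomial.evalEval_mul, Polynomial.evalEval_sub,
    Polynomial.evalEval_X, Polynomial.evalEval_C, Polynomial.evalEval_C, Polynomial.eval_C,
    Polynomial.eval_sub, Polynomial.eval_X, Polynomial.eval_C] at this
  exact ((mul_eq_zero.mp ((mul_eq_zero.mp this).resolve_left h2)).resolve_left h1)

/-- Distinct points of `ℂ` in four colours which determine bidegree `< k` exist as soon as there
are `2k + 4` points. -/
theorem exists_monochromaticDetermining {α : Type*} [Fintype α] [DecidableEq α] (col : α → Fin 4)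
    (k : ℕ) (Λ : Finset α) (hΛ : k = 0 ∨ 2 * k + 4 ≤ Λ.card) :
    ∃ c : α → ℂ, Set.InjOn c Λ ∧ MonochromaticDetermining col Λ c k := by
  induction k generalizing Λ with
  | zero =>
    obtain ⟨c⟩ : Nonempty (α ↪ ℂ) := by
      have : Infinite ℂ := inferInstance
      exact ⟨(Fintype.equivFin α).toEmbedding.trans
        (Fin.valEmbedding.trans (Infinite.natEmbedding ℂ))⟩
    exact ⟨c, c.injective.injOn, fun F hF _ => hF.eq_zero⟩
  | succ k ih =>
    replace hΛ : 2 * (k + 1) + 4 ≤ Λ.card := by omega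
    -- Extend a configuration on `Λ \ R` by a new common value on `R`.
    have hext : ∀ R ⊆ Λ, R.card ≤ 2 → ∃ (c : α → ℂ) (a : ℂ), Set.InjOn c ↑(Λ \ R) ∧
        MonochromaticDetermining col (Λ \ R) c k ∧ (∀ z ∈ R, c z = a) ∧
        ∀ z ∈ Λ \ R, c z ≠ a := by
      intro R hR hRc
      obtain ⟨c, hc, hgood⟩ := ih (Λ \ R) (by
        right
        rw [Finset.card_sdiff_of_subset hR]; omega)
      obtain ⟨a, ha⟩ := Infinite.exists_notMem_finset (Λ.image c)
      have hcc : ∀ w ∈ Λ \ R, (if w ∈ R then a else c w) = c w := fun w hw =>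
        if_neg (Finset.mem_sdiff.mp hw).2
      refine ⟨fun w => if w ∈ R then a else c w, a, ?_, hgood.congr hcc, fun z hz => if_pos hz, ?_⟩
      · intro z hz w hw hzw
        have h1 : (if z ∈ R then a else c z) = if w ∈ R then a else c w := hzw
        rw [hcc z hz, hcc w hw] at h1
        exact hc hz hw h1
      · intro w hw
        dsimp only
        rw [hcc w hw]
        rintro rfl
        exact ha (Finset.mem_image_of_mem c (Finset.mem_sdiff.mp hw).1)
    by_cases hA : ∃ i, k + 2 ≤ (Λ.filter (col · = i)).card
    · -- One colour suffices: add one point of this colour.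
      obtain ⟨i, hi⟩ := hA
      obtain ⟨z, hz⟩ : (Λ.filter (col · = i)).Nonempty := by
        rw [← Finset.card_pos]; omega
      have hzΛ := (Finset.mem_filter.mp hz).1
      obtain ⟨c, a, hc, hgood, hcR, hca⟩ := hext {z} (by simpa using hzΛ) (by simp)
      have hsub : (Λ.filter (col · = i)).erase z ⊆ Λ \ {z} := by
        intro w hw
        simp only [Finset.mem_erase, Finset.mem_filter] at hw
        simp [hw.1, hw.2.1]
      refine ⟨c, ?_, hgood.of_sdiff hcR hca (((Λ.filter (col · = i)).erase z).image c) ?_ ?_⟩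
      · intro x hx y hy hxy
        by_cases hxz : x = z <;> by_cases hyz : y = z
        · rw [hxz, hyz]
        · have := hca y (by simpa [hyz] using hy)
          rw [← hxy, hxz, hcR z (by simp)] at this
          exact absurd rfl this
        · have := hca x (by simpa [hxz] using hx)
          rw [hxy, hyz, hcR z (by simp)] at this
          exact absurd rfl this
        · exact hc (by simpa [hxz] using hx) (by simpa [hyz] using hy) hxy
      · rw [Finset.card_image_of_injOn (hc.mono (by exact_mod_cast hsub)),
          Finset.card_erase_of_mem hz]
        omega
      · intro b hb
        obtain ⟨w, hw, rfl⟩ := Finset.mem_image.mp hb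
        simp only [Finset.mem_erase, Finset.mem_filter] at hw hz
        exact ⟨w, hw.2.1, z, by simp, hz.1, hw.1.symm, hz.2.trans hw.2.2.symm, rfl⟩
    · -- Two colours contain together at least `k + 3` points: add a point of each of them at the
      -- same place, and move one of the two away afterwards.
      push Not at hA
      obtain ⟨i, j, hij, hcard⟩ : ∃ i j, i ≠ j ∧
          k + 3 ≤ (Λ.filter (col · = i)).card + (Λ.filter (col · = j)).card := by
        have hsum : Λ.card = ∑ i, (Λ.filter (col · = i)).card :=
          Finset.card_eq_sum_card_fiberwise fun _ _ => Finset.mem_coe.mpr (Finset.mem_univ _)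
        rw [Fin.sum_univ_four] at hsum
        by_cases h : k + 3 ≤ (Λ.filter (col · = 0)).card + (Λ.filter (col · = 1)).card
        · exact ⟨0, 1, by decide, h⟩
        · exact ⟨2, 3, by decide, by omega⟩
      have hi := hA i
      have hj := hA j
      obtain ⟨z, hz⟩ : (Λ.filter (col · = i)).Nonempty := by
        rw [← Finset.card_pos]; omega
      obtain ⟨w, hw⟩ : (Λ.filter (col · = j)).Nonempty := by
        rw [← Finset.card_pos]; omega
      have hz' := Finset.mem_filter.mp hz
      have hw' := Finset.mem_filter.mp hw
      have hzw : z ≠ w := by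
        rintro rfl
        exact hij (hz'.2.symm.trans hw'.2)
      obtain ⟨c, a, hc, hgood, hcR, hca⟩ := hext {z, w} (by
        intro x hx
        rcases Finset.mem_insert.mp hx with rfl | hx
        · exact hz'.1
        · rw [Finset.mem_singleton.mp hx]; exact hw'.1) Finset.card_le_two
      have hcz := hcR z (by simp)
      have hcw := hcR w (by simp)
      set T := (Λ.filter (col · = i)).erase z ∪ (Λ.filter (col · = j)).erase w with hT
      have hsub : T ⊆ Λ \ {z, w} := by
        intro x hx
        simp only [hT, Finset.mem_union, Finset.mem_erase, Finset.mem_filter] at hx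
        simp only [Finset.mem_sdiff, Finset.mem_insert, Finset.mem_singleton, not_or]
        rcases hx with ⟨h1, h2, h3⟩ | ⟨h1, h2, h3⟩
        · exact ⟨h2, h1, fun h => hij (by rw [← h3, h, hw'.2])⟩
        · exact ⟨h2, fun h => hij (by rw [← h3, h, hz'.2]), h1⟩
      have hgood' : MonochromaticDetermining col Λ c (k + 1) := by
        refine hgood.of_sdiff hcR hca (T.image c) ?_ ?_
        · rw [Finset.card_image_of_injOn (hc.mono (by exact_mod_cast hsub)), hT,
            Finset.card_union_of_disjoint, Finset.card_erase_of_mem hz,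
            Finset.card_erase_of_mem hw]
          · omega
          · rw [Finset.disjoint_left]
            intro x hx hx'
            simp only [Finset.mem_erase, Finset.mem_filter] at hx hx'
            exact hij (hx.2.2.symm.trans hx'.2.2)
        · intro b hb
          obtain ⟨x, hx, rfl⟩ := Finset.mem_image.mp hb
          simp only [hT, Finset.mem_union, Finset.mem_erase, Finset.mem_filter] at hx
          rcases hx with ⟨h1, h2, h3⟩ | ⟨h1, h2, h3⟩
          · exact ⟨x, h2, z, by simp, hz'.1, h1.symm, hz'.2.trans h3.symm, rfl⟩
          · exact ⟨x, h2, w, by simp, hw'.1, h1.symm, hw'.2.trans h3.symm, rfl⟩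
      have h1 := hgood'.eventually_update w
      rw [hcw] at h1
      have h2 : ∀ᶠ x in nhds a, x ∉ (Λ \ {z, w}).image c := by
        refine ((Λ \ {z, w}).image c).finite_toSet.isClosed.isOpen_compl.mem_nhds ?_
        intro h
        obtain ⟨x, hx, hxa⟩ := Finset.mem_image.mp (Finset.mem_coe.mp h)
        exact hca x hx hxa
      obtain ⟨b, ⟨hb1, hb2⟩, hb3⟩ := (((h1.and h2).filter_mono nhdsWithin_le_nhds).and
        (self_mem_nhdsWithin (a := a) (s := {a}ᶜ))).exists
      refine ⟨Function.update c w b, ?_, hb1⟩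
      have hval : ∀ x ∈ Λ, x ≠ w → Function.update c w b x = c x ∧ c x ≠ b := by
        intro x hx hxw
        refine ⟨Function.update_of_ne hxw _ _, ?_⟩
        rintro rfl
        by_cases hxz : x = z
        · rw [hxz, hcz] at hb3
          exact hb3 rfl
        · exact hb2 (Finset.mem_image_of_mem c (by simp [hx, hxz, hxw]))
      intro x hx y hy hxy
      by_cases hxw : x = w <;> by_cases hyw : y = w
      · rw [hxw, hyw]
      · obtain ⟨h3, h4⟩ := hval y hy hyw
        rw [hxw, Function.update_self, h3] at hxy
        exact absurd hxy.symm h4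
      · obtain ⟨h3, h4⟩ := hval x hx hxw
        rw [hyw, Function.update_self, h3] at hxy
        exact absurd hxy h4
      · rw [(hval x hx hxw).1, (hval y hy hyw).1] at hxy
        by_cases hxz : x = z <;> by_cases hyz : y = z
        · rw [hxz, hyz]
        · have := hca y (by simp [Finset.mem_coe.mp hy, hyz, hyw])
          rw [← hxy, hxz, hcz] at this
          exact absurd rfl this
        · have := hca x (by simp [Finset.mem_coe.mp hx, hxz, hxw])
          rw [hxy, hyz, hcz] at this
          exact absurd rfl this
        · exact hc (by simp [Finset.mem_coe.mp hx, hxz, hxw])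
            (by simp [Finset.mem_coe.mp hy, hyz, hyw]) hxy

end BivariateInterpolation

/-! ### Symmetric functions with vanishing moments -/

namespace BivariateInterpolation

open Polynomial Polynomial.Bivariate

/-- A function `r` on a set `Z` of `n` points whose weighted moments
`∑ m ∈ Z, r m / ∏ (m - z) * m ^ i` vanish for `i ≤ N` is given by a polynomial of degree less than
`n - N - 1`. -/
lemma exists_polynomial_of_moments (Z : Finset ℂ) (N k : ℕ) (hZ : Z.card ≤ N + 1 + k)
    (r : ℂ → ℂ)
    (h : ∀ i ≤ N, ∑ m ∈ Z, r m * m ^ i / ∏ z ∈ Z.erase m, (m - z) = 0) :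
    ∃ p : ℂ[X], p.degree < k ∧ ∀ m ∈ Z, p.eval m = r m := by
  have hinj : Set.InjOn (id : ℂ → ℂ) Z := Function.injective_id.injOn
  set p := Lagrange.interpolate Z id r with hp
  have hpm : ∀ m ∈ Z, p.eval m = r m := fun m hm => Lagrange.eval_interpolate_at_node r hinj hm
  refine ⟨p, ?_, hpm⟩
  by_contra hk
  rw [not_lt] at hk
  have hp0 : p ≠ 0 := by
    intro h0
    rw [h0] at hk
    simp at hk
  have hlt : p.degree < Z.card := Lagrange.degree_interpolate_lt r hinj
  rw [Polynomial.degree_eq_natDegree hp0] at hk hlt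
  have hk' : k ≤ p.natDegree := by exact_mod_cast hk
  have hlt' : p.natDegree < Z.card := by exact_mod_cast hlt
  -- Multiply `p` by a power of `X` to bring its degree to `n - 1`; the moment is then the
  -- leading coefficient.
  have hdeg : (p * Polynomial.X ^ (Z.card - 1 - p.natDegree)).degree + 1 =
      (Z.card : WithBot ℕ) := by
    rw [Polynomial.degree_mul, Polynomial.degree_X_pow, Polynomial.degree_eq_natDegree hp0]
    norm_cast
    omega
  have hlead := Lagrange.leadingCoeff_eq_sum hinj hdeg.symm
  have h0 := h (Z.card - 1 - p.natDegree) (by omega)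
  rw [Polynomial.leadingCoeff_mul_X_pow] at hlead
  refine Polynomial.leadingCoeff_ne_zero.mpr hp0 (hlead.trans ?_)
  rw [← h0]
  refine Finset.sum_congr rfl fun m hm => ?_
  simp [hpm m hm]

/-- A symmetric function on pairs of points of `Z` which extends in each variable to a polynomial
of degree less than `k` is the restriction of a bivariate polynomial of bidegree less than `k`. -/
lemma exists_bidegreeLT (Z : Finset ℂ) (k : ℕ) (hZ : 2 * k + 1 ≤ Z.card ∨ k = 0) (H : ℂ → ℂ[X])
    (hdeg : ∀ c ∈ Z, (H c).degree < k)
    (hsymm : ∀ c ∈ Z, ∀ m ∈ Z, c ≠ m → (H c).eval m = (H m).eval c) :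
    ∃ F : ℂ[X][Y], BidegreeLT k F ∧ ∀ c ∈ Z, F.eval (Polynomial.C c) = H c := by
  obtain ⟨A, hAZ, hA⟩ := Finset.exists_subset_card_eq (s := Z) (n := k) (by omega)
  have hinj : Set.InjOn (id : ℂ → ℂ) A := Function.injective_id.injOn
  have hF : ∀ c, (∑ a ∈ A, (Lagrange.basis A id a).map Polynomial.C * Polynomial.C (H a)).eval
      (Polynomial.C c) = ∑ a ∈ A, Polynomial.C ((Lagrange.basis A id a).eval c) * H a := by
    intro c
    simp [Polynomial.eval_finsetSum, Polynomial.eval_map_apply]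
  refine ⟨∑ a ∈ A, (Lagrange.basis A id a).map Polynomial.C * Polynomial.C (H a), ⟨?_, ?_⟩, ?_⟩
  · refine (Polynomial.degree_sum_le _ _).trans_lt ?_
    rw [Finset.sup_lt_iff (by exact WithBot.bot_lt_coe k)]
    intro a ha
    have h1 : ((Lagrange.basis A id a).map Polynomial.C * Polynomial.C (H a) : ℂ[X][Y]).degree ≤
        (Lagrange.basis A id a).degree + 0 := by
      refine (Polynomial.degree_mul_le _ _).trans ?_
      gcongr
      · exact Polynomial.degree_map_le
      · exact Polynomial.degree_C_le
    refine h1.trans_lt ?_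
    have h2 : 0 < A.card := Finset.card_pos.mpr ⟨a, ha⟩
    rw [Lagrange.degree_basis hinj ha, add_zero]
    norm_cast
    omega
  · intro n
    rw [Polynomial.finsetSum_coeff]
    refine (Polynomial.degree_sum_le _ _).trans_lt ?_
    rw [Finset.sup_lt_iff (by exact WithBot.bot_lt_coe k)]
    intro a ha
    rw [Polynomial.coeff_mul_C, Polynomial.coeff_map, mul_comm]
    exact degree_mul_C_lt (hdeg a (hAZ ha)) _
  · intro c hc
    rw [hF]
    -- Both sides have degree `< k` and agree at the points of `Z` outside `A ∪ {c}`.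
    refine Polynomial.eq_of_degrees_lt_of_eval_finset_eq ((Z \ A).erase c) ?_ ?_ ?_
    · refine (Polynomial.degree_sum_le _ _).trans_lt ?_
      rw [Finset.sup_lt_iff (by exact WithBot.bot_lt_coe _)]
      intro a ha
      rw [mul_comm]
      refine (degree_mul_C_lt (hdeg a (hAZ ha)) _).trans_le ?_
      have := Finset.pred_card_le_card_erase (s := Z \ A) (a := c)
      rw [Finset.card_sdiff_of_subset hAZ] at this
      have h2 : 0 < A.card := Finset.card_pos.mpr ⟨a, ha⟩
      norm_cast
      omega
    · refine (hdeg c hc).trans_le ?_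
      have := Finset.pred_card_le_card_erase (s := Z \ A) (a := c)
      rw [Finset.card_sdiff_of_subset hAZ] at this
      norm_cast
      omega
    · intro m hm
      simp only [Finset.mem_erase, Finset.mem_sdiff] at hm
      obtain ⟨hmc, hmZ, hmA⟩ := hm
      rw [Polynomial.eval_finsetSum, hsymm c hc m hmZ hmc.symm]
      have h1 : H m = Lagrange.interpolate A id fun a => (H m).eval a :=
        Lagrange.eq_interpolate hinj ((hdeg m hmZ).trans_le (by rw [hA]))
      conv_rhs => rw [h1, Lagrange.interpolate_apply, Polynomial.eval_finsetSum]
      refine Finset.sum_congr rfl fun a ha => ?_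
      rw [Polynomial.eval_mul, Polynomial.eval_mul, Polynomial.eval_C, Polynomial.eval_C,
        hsymm a (hAZ ha) m hmZ (by rintro rfl; exact hmA ha), mul_comm]

/-- If `2N` coloured points determine bidegree `< N - 2`, then a symmetric function `φ` on pairs of
differently coloured points with `∑ m, (m - c) m ^ i φ c m = 0` for all `c` and all `i ≤ N`
vanishes. -/
theorem eq_zero_of_symmetric_of_moments {κ : Type*} (col : ℂ → κ) (Z : Finset ℂ) (N : ℕ)
    (hZ : Z.card = 2 * N) (hgood : MonochromaticDetermining col Z id (N - 2)) (φ : ℂ → ℂ → ℂ)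
    (hsymm : ∀ c ∈ Z, ∀ m ∈ Z, φ c m = φ m c)
    (hmono : ∀ c ∈ Z, ∀ m ∈ Z, c ≠ m → col c = col m → φ c m = 0)
    (hmom : ∀ c ∈ Z, ∀ i ≤ N, ∑ m ∈ Z.erase c, (m - c) * m ^ i * φ c m = 0) :
    ∀ c ∈ Z, ∀ m ∈ Z, c ≠ m → φ c m = 0 := by
  have hprod : ∀ m ∈ Z, ∏ z ∈ Z.erase m, (m - z) ≠ 0 := by
    intro m _
    rw [Finset.prod_ne_zero_iff]
    intro z hz
    exact sub_ne_zero.mpr (Finset.ne_of_mem_erase hz).symm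
  have hG : ∀ c ∈ Z, ∃ G : ℂ[X], G.degree < ((N - 2 : ℕ) : WithBot ℕ) ∧
      ∀ m ∈ Z.erase c, G.eval m = φ c m * ∏ z ∈ Z.erase m, (m - z) := by
    intro c hc
    refine exists_polynomial_of_moments (Z.erase c) N (N - 2) ?_ _ ?_
    · rw [Finset.card_erase_of_mem hc]; omega
    · intro i hi
      rw [← hmom c hc i hi]
      refine Finset.sum_congr rfl fun m hm => ?_
      have hm' := Finset.mem_erase.mp hm
      have h1 : ∏ z ∈ Z.erase m, (m - z) = (m - c) * ∏ z ∈ (Z.erase c).erase m, (m - z) := by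
        rw [Finset.erase_right_comm,
          Finset.mul_prod_erase _ (fun z => m - z) (Finset.mem_erase.mpr ⟨hm'.1.symm, hc⟩)]
      have h2 := hprod m hm'.2
      rw [h1] at h2 ⊢
      have h3 := right_ne_zero_of_mul h2
      field_simp
  choose! G hGdeg hGeval using hG
  obtain ⟨F, hF, hFH⟩ := exists_bidegreeLT Z (N - 2) (by omega)
    (fun c => G c * Polynomial.C (∏ z ∈ Z.erase c, (c - z)))
    (fun c hc => degree_mul_C_lt (hGdeg c hc) _)
    (by
      intro c hc m hm hcm
      simp only [Polynomial.eval_mul, Polynomial.eval_C]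
      rw [hGeval c hc m (Finset.mem_erase.mpr ⟨hcm.symm, hm⟩),
        hGeval m hm c (Finset.mem_erase.mpr ⟨hcm, hc⟩), hsymm c hc m hm]
      ring)
  have hval : ∀ c ∈ Z, ∀ m ∈ Z, c ≠ m → F.evalEval m c =
      φ c m * (∏ z ∈ Z.erase m, (m - z)) * ∏ z ∈ Z.erase c, (c - z) := by
    intro c hc m hm hcm
    rw [Polynomial.evalEval, hFH c hc, Polynomial.eval_mul, Polynomial.eval_C,
      hGeval c hc m (Finset.mem_erase.mpr ⟨hcm.symm, hm⟩)]
  have hF0 : F = 0 := hgood F hF (by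
    intro m hm c hc hmc hcol
    rw [id, id, hval c hc m hm hmc.symm, hmono c hc m hm hmc.symm hcol.symm, zero_mul, zero_mul])
  intro c hc m hm hcm
  have := hval c hc m hm hcm
  rw [hF0, Polynomial.evalEval_zero] at this
  have h1 := (mul_eq_zero.mp this.symm).resolve_right (hprod c hc)
  exact (mul_eq_zero.mp h1).resolve_right (hprod m hm)

end BivariateInterpolation

/-! ### Homogeneous components of products -/

namespace MvPolynomial

/-- Taking a weighted homogeneous component commutes with multiplication by a weighted homogeneous
polynomial, up to the shift of the degree. -/
lemma weightedHomogeneousComponent_mul_right {R σ M : Type*} [CommSemiring R]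
    [AddCancelCommMonoid M] (w : σ → M) {q : MvPolynomial σ R} {j : M}
    (hq : q.IsWeightedHomogeneous w j) (p : MvPolynomial σ R) (i : M) :
    weightedHomogeneousComponent w (i + j) (p * q) = weightedHomogeneousComponent w i p * q := by
  classical
  let _ := weightedGradedAlgebra R w
  have h := DirectSum.coe_decompose_mul_add_of_right_mem (weightedHomogeneousSubmodule R w)
    (i := i) (a := p) (b := q) (j := j) hq
  have hd : ∀ (φ : MvPolynomial σ R) (m : M),
      (DirectSum.decompose (weightedHomogeneousSubmodule R w) φ m : MvPolynomial σ R) =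
        weightedHomogeneousComponent w m φ := fun φ m =>
    weightedDecomposition.decompose'_apply R w φ m
  rwa [hd, hd] at h

end MvPolynomial

/-! ### Tangent lines of a conic and their intersection points -/

namespace TangentLines

/-- The lines `x₀ + c x₁ + c² x₂ = 0` are the tangent lines of a conic. -/
noncomputable def line (c : ℂ) : MvPolynomial (Fin 3) ℂ := X 0 + C c * X 1 + C (c ^ 2) * X 2

/-- The intersection point `(ab : -(a + b) : 1)` of the lines with parameters `a` and `b`. -/
def node (a b : ℂ) : Fin 3 → ℂ := ![a * b, -(a + b), 1]

/-- The equation of the union of the lines with parameters in `A`. -/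
noncomputable def lines (A : Finset ℂ) : MvPolynomial (Fin 3) ℂ := ∏ a ∈ A, line a

/-- A polynomial, homogeneous or not, vanishes at the projective point `node a b` if it vanishes at
all the nonzero multiples of the vector `node a b`. -/
def VanishesAt (p : MvPolynomial (Fin 3) ℂ) (a b : ℂ) : Prop :=
  ∀ s : ℂ, s ≠ 0 → eval (s • node a b) p = 0

lemma node_comm (a b : ℂ) : node a b = node b a := by
  simp [node, mul_comm, add_comm]

lemma isHomogeneous_line (c : ℂ) : (line c).IsHomogeneous 1 :=
  ((isHomogeneous_X ℂ 0).add (isHomogeneous_C_mul_X c 1)).add (isHomogeneous_C_mul_X (c ^ 2) 2)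

lemma isHomogeneous_lines (A : Finset ℂ) : (lines A).IsHomogeneous A.card := by
  have := IsHomogeneous.prod A (fun a => line a) (fun _ => 1) fun a _ => isHomogeneous_line a
  simpa [lines] using this

lemma eval_smul_node_line (s a b c : ℂ) :
    eval (s • node a b) (line c) = s * ((c - a) * (c - b)) := by
  simp [line, node]
  ring

lemma eval_node_line (a b c : ℂ) : eval (node a b) (line c) = (c - a) * (c - b) := by
  have := eval_smul_node_line 1 a b c
  rwa [one_smul, one_mul] at this

lemma eval_node_lines (a b : ℂ) (A : Finset ℂ) :
    eval (node a b) (lines A) = ∏ c ∈ A, (c - a) * (c - b) := by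
  simp [lines, map_prod, eval_node_line]

lemma eval_node_lines_eq_zero {a b : ℂ} {A : Finset ℂ} (h : a ∈ A ∨ b ∈ A) :
    eval (node a b) (lines A) = 0 := by
  rw [eval_node_lines]
  rcases h with h | h
  · exact Finset.prod_eq_zero h (by simp)
  · exact Finset.prod_eq_zero h (by simp)

lemma eval_node_lines_ne_zero {a b : ℂ} {A : Finset ℂ} (ha : a ∉ A) (hb : b ∉ A) :
    eval (node a b) (lines A) ≠ 0 := by
  rw [eval_node_lines, Finset.prod_ne_zero_iff]
  intro c hc
  refine mul_ne_zero (sub_ne_zero.mpr ?_) (sub_ne_zero.mpr ?_)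
  · rintro rfl; exact ha hc
  · rintro rfl; exact hb hc

lemma eval_smul_of_isHomogeneous {p : MvPolynomial (Fin 3) ℂ} {n : ℕ} (hp : p.IsHomogeneous n)
    (s : ℂ) (x : Fin 3 → ℂ) : eval (s • x) p = s ^ n * eval x p := by
  rw [eval_eq, eval_eq, Finset.mul_sum]
  refine Finset.sum_congr rfl fun d hd => ?_
  have h1 : ∏ i ∈ d.support, (s • x) i ^ d i = s ^ n * ∏ i ∈ d.support, x i ^ d i := by
    simp only [Pi.smul_apply, smul_eq_mul, mul_pow, Finset.prod_mul_distrib]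
    rw [Finset.prod_pow_eq_pow_sum, ← hp.degree_eq_sum_deg_support hd]
  rw [h1]
  ring

lemma vanishesAt_of_isHomogeneous {p : MvPolynomial (Fin 3) ℂ} {n : ℕ} (hp : p.IsHomogeneous n)
    {a b : ℂ} (h : eval (node a b) p = 0) : VanishesAt p a b := fun s _ => by
  rw [eval_smul_of_isHomogeneous hp, h, mul_zero]

/-- A factor which does not vanish at a point may be cancelled. -/
lemma VanishesAt.of_mul {p q : MvPolynomial (Fin 3) ℂ} {a b : ℂ} (h : VanishesAt (p * q) a b)
    {n : ℕ} (hq : q.IsHomogeneous n) (hq0 : eval (node a b) q ≠ 0) : VanishesAt p a b := by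
  intro s hs
  have := h s hs
  rw [map_mul, eval_smul_of_isHomogeneous hq] at this
  exact (mul_eq_zero.mp this).resolve_right (mul_ne_zero (pow_ne_zero _ hs) hq0)

lemma VanishesAt.sub {p q : MvPolynomial (Fin 3) ℂ} {a b : ℂ} (hp : VanishesAt p a b)
    (hq : VanishesAt q a b) : VanishesAt (p - q) a b := fun s hs => by
  rw [map_sub, hp s hs, hq s hs, sub_zero]

lemma VanishesAt.mul_left {p : MvPolynomial (Fin 3) ℂ} {a b : ℂ} (hp : VanishesAt p a b)
    (q : MvPolynomial (Fin 3) ℂ) : VanishesAt (q * p) a b := fun s hs => by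
  rw [map_mul, hp s hs, mul_zero]

lemma VanishesAt.sum {ι : Type*} {t : Finset ι} {p : ι → MvPolynomial (Fin 3) ℂ} {a b : ℂ}
    (h : ∀ i ∈ t, VanishesAt (p i) a b) : VanishesAt (∑ i ∈ t, p i) a b := fun s hs => by
  rw [map_sum]
  exact Finset.sum_eq_zero fun i hi => h i hi s hs

lemma vanishesAt_lines {a b : ℂ} {A : Finset ℂ} (h : a ∈ A ∨ b ∈ A) : VanishesAt (lines A) a b :=
  vanishesAt_of_isHomogeneous (isHomogeneous_lines A) (eval_node_lines_eq_zero h)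

lemma lines_eq_mul_erase {A : Finset ℂ} {a : ℂ} (ha : a ∈ A) :
    lines A = line a * lines (A.erase a) :=
  (Finset.mul_prod_erase A line ha).symm

lemma lines_insert {A : Finset ℂ} {a : ℂ} (ha : a ∉ A) :
    lines (insert a A) = line a * lines A :=
  Finset.prod_insert ha

/-- The ideal of a point is generated by the equations of two lines through it. -/
lemma VanishesAt.exists_eq {p : MvPolynomial (Fin 3) ℂ} {a b : ℂ} (h : VanishesAt p a b)
    (hab : a ≠ b) : ∃ u v, p = u * line a + v * line b := by
  have hba : b - a ≠ 0 := sub_ne_zero.mpr hab.symm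
  set I : Ideal (MvPolynomial (Fin 3) ℂ) := Ideal.span {line a, line b} with hI
  have h0 : X 0 - C (a * b) * X 2 ∈ I := by
    refine Ideal.mem_span_pair.mpr ⟨C (b / (b - a)), C (-a / (b - a)), ?_⟩
    have h1 : (C (b / (b - a)) : MvPolynomial (Fin 3) ℂ) = C b * C (1 / (b - a)) := by
      rw [← C_mul]; congr 1; ring
    have h2 : (C (-a / (b - a)) : MvPolynomial (Fin 3) ℂ) = -C a * C (1 / (b - a)) := by
      rw [← C_neg, ← C_mul]; congr 1; ring
    have h3 : (C (1 / (b - a)) : MvPolynomial (Fin 3) ℂ) * (C b - C a) = 1 := by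
      rw [← C_sub, ← C_mul, one_div_mul_cancel hba, C_1]
    simp only [line, h1, h2, C_mul, C_pow]
    linear_combination (X 0 - C a * C b * X 2) * h3
  have h1 : X 1 + C (a + b) * X 2 ∈ I := by
    refine Ideal.mem_span_pair.mpr ⟨-C (1 / (b - a)), C (1 / (b - a)), ?_⟩
    have h3 : (C (1 / (b - a)) : MvPolynomial (Fin 3) ℂ) * (C b - C a) = 1 := by
      rw [← C_sub, ← C_mul, one_div_mul_cancel hba, C_1]
    simp only [line, C_add, C_pow]
    linear_combination (X 1 + (C a + C b) * X 2) * h3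
  -- Modulo `I`, every polynomial is a polynomial in `x₂`.
  set w : MvPolynomial (Fin 3) ℂ →ₐ[ℂ] MvPolynomial (Fin 3) ℂ :=
    aeval ![C (a * b) * X 2, -(C (a + b) * X 2), X 2] with hw
  have hmk : (Ideal.Quotient.mkₐ ℂ I).comp w = Ideal.Quotient.mkₐ ℂ I := by
    refine algHom_ext fun i => ?_
    simp only [AlgHom.comp_apply, hw, aeval_X, Ideal.Quotient.mkₐ_eq_mk]
    refine (Ideal.Quotient.eq.mpr ?_).symm
    fin_cases i
    · exact h0
    · simpa using h1
    · simp
  have hw0 : w p = 0 := by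
    have hX : (X 2 : MvPolynomial (Fin 3) ℂ) * w p = 0 := by
      refine MvPolynomial.funext fun x => ?_
      rw [map_mul, eval_X, map_zero]
      rcases eq_or_ne (x 2) 0 with hx | hx
      · rw [hx, zero_mul]
      have h2 : eval x (w p) = eval (x 2 • node a b) p := by
        have h3 : ((aeval x : MvPolynomial (Fin 3) ℂ →ₐ[ℂ] ℂ).comp w) =
            aeval (x 2 • node a b) := by
          refine algHom_ext fun i => ?_
          fin_cases i
          · simp [hw, node, mul_comm]
          · simp [hw, node]
            ring
          · simp [hw, node]
        have h4 := DFunLike.congr_fun h3 p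
        simpa [aeval_eq_eval] using h4
      rw [h2, h _ hx, mul_zero]
    exact (mul_eq_zero.mp hX).resolve_left (X_ne_zero 2)
  have hmem : p ∈ I := by
    have := DFunLike.congr_fun hmk p
    rw [AlgHom.comp_apply, hw0, map_zero] at this
    exact Ideal.Quotient.eq_zero_iff_mem.mp this.symm
  obtain ⟨u, v, huv⟩ := Ideal.mem_span_pair.mp hmem
  exact ⟨u, v, huv.symm⟩

/-- A polynomial vanishing at the points of the line `c` on the lines `B` is in the ideal
generated by `c` and `B`. -/
lemma exists_eq_line_lines {p : MvPolynomial (Fin 3) ℂ} {c : ℂ} {B : Finset ℂ} (hc : c ∉ B)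
    (h : ∀ b ∈ B, VanishesAt p c b) : ∃ u v, p = u * line c + v * lines B := by
  induction B using Finset.induction_on with
  | empty => exact ⟨0, p, by simp [lines]⟩
  | insert b B hb ih =>
    simp only [Finset.mem_insert, not_or] at hc
    obtain ⟨u, v, rfl⟩ := ih hc.2 fun b' hb' => h b' (Finset.mem_insert_of_mem hb')
    have h1 : VanishesAt (v * lines B) c b := by
      intro s hs
      have := h b (Finset.mem_insert_self b B) s hs
      rwa [map_add, map_mul, eval_smul_node_line, sub_self, zero_mul, mul_zero, mul_zero,
        zero_add] at this
    obtain ⟨u', v', hv⟩ := (h1.of_mul (isHomogeneous_lines B)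
      (eval_node_lines_ne_zero hc.2 hb)).exists_eq hc.1
    refine ⟨u + u' * lines B, v', ?_⟩
    rw [lines_insert hb, hv]
    ring

/-- Two unions of lines `A` and `B` which meet transversally: a polynomial vanishing at the
intersection points is in the ideal generated by the two equations. -/
lemma exists_eq_lines_lines {p : MvPolynomial (Fin 3) ℂ} {A B : Finset ℂ} (hAB : Disjoint A B)
    (h : ∀ a ∈ A, ∀ b ∈ B, VanishesAt p a b) : ∃ u v, p = u * lines A + v * lines B := by
  induction A using Finset.induction_on generalizing p with
  | empty => exact ⟨p, 0, by simp [lines]⟩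
  | insert c A hc ih =>
    rw [Finset.disjoint_insert_left] at hAB
    obtain ⟨u, v, rfl⟩ := exists_eq_line_lines hAB.1 (h c (Finset.mem_insert_self c A))
    obtain ⟨u', v', rfl⟩ := ih hAB.2 (p := u) (by
      intro a ha b hb
      have hac : c ≠ a := by rintro rfl; exact hc ha
      have hbc : c ≠ b := by rintro rfl; exact hAB.1 hb
      have h1 := (h a (Finset.mem_insert_of_mem ha) b hb).sub
        ((vanishesAt_lines (a := a) (Or.inr hb)).mul_left v)
      rw [add_sub_cancel_right] at h1
      refine h1.of_mul (isHomogeneous_line c) ?_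
      rw [eval_node_line]
      exact mul_ne_zero (sub_ne_zero.mpr hac) (sub_ne_zero.mpr hbc))
    exact ⟨u', v' * line c + v, by rw [lines_insert hc]; ring⟩

/-- A polynomial vanishing at all double points of the union of the lines `A` is in the ideal
generated by the equations of the unions of all lines but one. -/
lemma exists_eq_sum_lines_erase {p : MvPolynomial (Fin 3) ℂ} {A : Finset ℂ} (hA : A.Nonempty)
    (h : ∀ a ∈ A, ∀ b ∈ A, a ≠ b → VanishesAt p a b) :
    ∃ q : ℂ → MvPolynomial (Fin 3) ℂ, p = ∑ a ∈ A, q a * lines (A.erase a) := by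
  induction hA using Finset.Nonempty.cons_induction with
  | singleton a => exact ⟨fun _ => p, by simp [lines]⟩
  | cons c A hc hA ih =>
    obtain ⟨q, hq⟩ := ih fun a ha b hb =>
      h a (Finset.mem_cons_of_mem ha) b (Finset.mem_cons_of_mem hb)
    have hne : ∀ a ∈ A, c ≠ a := by rintro a ha rfl; exact hc ha
    have key : ∀ a ∈ A, ∃ u v, q a = u * line c + v * line a := by
      intro a ha
      have h1 := h c (Finset.mem_cons_self c A) a (Finset.mem_cons_of_mem ha) (hne a ha)
      rw [hq, ← Finset.add_sum_erase A _ ha] at h1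
      have h2 : VanishesAt (∑ b ∈ A.erase a, q b * lines (A.erase b)) c a :=
        VanishesAt.sum fun b hb => (vanishesAt_lines (Or.inr (Finset.mem_erase.mpr
          ⟨(Finset.ne_of_mem_erase hb).symm, ha⟩))).mul_left (q b)
      have h3 := h1.sub h2
      rw [add_sub_cancel_right] at h3
      refine (h3.of_mul (isHomogeneous_lines _) ?_).exists_eq (hne a ha)
      exact eval_node_lines_ne_zero (fun h => hc (Finset.mem_of_mem_erase h)) (by simp)
    choose! u v huv using key
    refine ⟨fun a => if a = c then ∑ b ∈ A, v b else u a, ?_⟩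
    dsimp only
    rw [Finset.sum_cons, if_pos rfl, Finset.cons_eq_insert, Finset.erase_insert hc, hq,
      Finset.sum_mul, ← Finset.sum_add_distrib]
    refine Finset.sum_congr rfl fun a ha => ?_
    rw [if_neg (hne a ha).symm, Finset.erase_insert_of_ne (hne a ha),
      lines_insert (fun h => hc (Finset.mem_of_mem_erase h)), huv a ha, lines_eq_mul_erase ha]
    ring

/-- Interpolation at points which are separated by homogeneous polynomials of degree `n`. -/
lemma exists_interpolation_of_separated (T : Finset (Fin 3 → ℂ)) (n : ℕ)
    (h : ∀ x ∈ T, ∃ q : MvPolynomial (Fin 3) ℂ, q.IsHomogeneous n ∧ eval x q ≠ 0 ∧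
      ∀ y ∈ T, y ≠ x → eval y q = 0) (val : (Fin 3 → ℂ) → ℂ) :
    ∃ q : MvPolynomial (Fin 3) ℂ, q.IsHomogeneous n ∧ ∀ x ∈ T, eval x q = val x := by
  choose! q hq hqx hqy using h
  refine ⟨∑ x ∈ T, C (val x / eval x (q x)) * q x,
    IsHomogeneous.sum _ _ _ fun x hx => (hq x hx).C_mul _, fun x hx => ?_⟩
  rw [map_sum, Finset.sum_eq_single x]
  · rw [map_mul, eval_C, div_mul_cancel₀ _ (hqx x hx)]
  · intro y hy hyx
    rw [map_mul, hqy y hy x hx hyx.symm, mul_zero]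
  · exact fun hx' => absurd hx hx'

/-- For two unions of lines `A` and `B`, the homogeneous polynomial vanishing at all the
intersection points but `node a b`. The factor `x₂ ^ s` adjusts the degree. -/
noncomputable def nodeBasis (A B : Finset ℂ) (s : ℕ) (a b : ℂ) : MvPolynomial (Fin 3) ℂ :=
  lines (A.erase a) * lines (B.erase b) * X 2 ^ s

lemma eval_node_X_two_pow (a b : ℂ) (s : ℕ) :
    eval (node a b) (X 2 ^ s : MvPolynomial (Fin 3) ℂ) = 1 := by
  simp [node]

lemma isHomogeneous_nodeBasis {A B : Finset ℂ} {s n : ℕ} {a b : ℂ} (ha : a ∈ A) (hb : b ∈ B)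
    (hn : A.card + B.card + s = n + 2) : (nodeBasis A B s a b).IsHomogeneous n := by
  have h := ((isHomogeneous_lines (A.erase a)).mul (isHomogeneous_lines (B.erase b))).mul
    (isHomogeneous_X_pow (R := ℂ) (2 : Fin 3) s)
  rw [Finset.card_erase_of_mem ha, Finset.card_erase_of_mem hb] at h
  have hA := Finset.card_pos.mpr ⟨a, ha⟩
  have hB := Finset.card_pos.mpr ⟨b, hb⟩
  have hdeg : A.card - 1 + (B.card - 1) + s = n := by omega
  rwa [hdeg] at h

lemma eval_nodeBasis_ne_zero {A B : Finset ℂ} (hAB : Disjoint A B) {s : ℕ} {a b : ℂ}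
    (ha : a ∈ A) (hb : b ∈ B) : eval (node a b) (nodeBasis A B s a b) ≠ 0 := by
  rw [nodeBasis, map_mul, map_mul, eval_node_X_two_pow, mul_one]
  have h1 : b ∉ A := fun h => Finset.disjoint_left.mp hAB h hb
  have h2 : a ∉ B := fun h => Finset.disjoint_left.mp hAB ha h
  exact mul_ne_zero (eval_node_lines_ne_zero (by simp) fun h => h1 (Finset.mem_of_mem_erase h))
    (eval_node_lines_ne_zero (fun h => h2 (Finset.mem_of_mem_erase h)) (by simp))

lemma eval_nodeBasis_of_ne {A B : Finset ℂ} {s : ℕ} {a b a' b' : ℂ} (ha' : a' ∈ A) (hb' : b' ∈ B)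
    (h : a' ≠ a ∨ b' ≠ b) : eval (node a' b') (nodeBasis A B s a b) = 0 := by
  rw [nodeBasis, map_mul, map_mul]
  rcases h with h | h
  · rw [eval_node_lines_eq_zero (Or.inl (Finset.mem_erase.mpr ⟨h, ha'⟩)), zero_mul, zero_mul]
  · rw [eval_node_lines_eq_zero (A := B.erase b) (Or.inr (Finset.mem_erase.mpr ⟨h, hb'⟩)),
      mul_zero, zero_mul]

/-- Homogeneous polynomials of large degree take arbitrary values at the double points of a union
of lines. -/
lemma exists_interpolation_self {A : Finset ℂ} {n : ℕ} (hn : A.card ≤ n + 2)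
    (val : (Fin 3 → ℂ) → ℂ) :
    ∃ q : MvPolynomial (Fin 3) ℂ, q.IsHomogeneous n ∧
      ∀ a ∈ A, ∀ b ∈ A, a ≠ b → eval (node a b) q = val (node a b) := by
  classical
  obtain ⟨q, hq, hqv⟩ := exists_interpolation_of_separated
    (A.offDiag.image fun p => node p.1 p.2) n (by
      intro x hx
      obtain ⟨⟨a, b⟩, hab, rfl⟩ := Finset.mem_image.mp hx
      obtain ⟨ha, hb, hne⟩ := Finset.mem_offDiag.mp hab
      dsimp only at ha hb hne
      have hba : b ∈ A.erase a := Finset.mem_erase.mpr ⟨hne.symm, hb⟩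
      refine ⟨lines ((A.erase a).erase b) * X 2 ^ (n + 2 - A.card), ?_, ?_, ?_⟩
      · have h := (isHomogeneous_lines ((A.erase a).erase b)).mul
          (isHomogeneous_X_pow (R := ℂ) (2 : Fin 3) (n + 2 - A.card))
        have h1 := Finset.card_pos.mpr ⟨b, hba⟩
        rw [Finset.card_erase_of_mem hba] at h
        rw [Finset.card_erase_of_mem ha] at h h1
        have hdeg : A.card - 1 - 1 + (n + 2 - A.card) = n := by omega
        rwa [hdeg] at h
      · rw [map_mul, eval_node_X_two_pow, mul_one]
        exact eval_node_lines_ne_zero (by simp) (by simp)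
      · intro y hy hyx
        obtain ⟨⟨a', b'⟩, hab', rfl⟩ := Finset.mem_image.mp hy
        obtain ⟨ha', hb', hne'⟩ := Finset.mem_offDiag.mp hab'
        dsimp only at ha' hb' hne' hyx ⊢
        rw [map_mul, eval_node_lines_eq_zero, zero_mul]
        simp only [Finset.mem_erase, ha', hb', and_true]
        by_contra! h
        obtain ⟨h1, h2⟩ := h
        have h3 : a' = a ∨ a' = b := by
          by_contra! h'
          exact h'.1 (h1 h'.2)
        have h4 : b' = a ∨ b' = b := by
          by_contra! h'
          exact h'.1 (h2 h'.2)
        rcases h3 with rfl | rfl <;> rcases h4 with rfl | rfl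
        · exact hne' rfl
        · exact hyx rfl
        · exact hyx (node_comm _ _)
        · exact hne' rfl) val
  exact ⟨q, hq, fun a ha b hb hab =>
    hqv (node a b) (Finset.mem_image.mpr ⟨(a, b), Finset.mem_offDiag.mpr ⟨ha, hb, hab⟩, rfl⟩)⟩

end TangentLines

/-! ### Directional derivatives of products of lines -/

namespace TangentLines

/-- An ideal containing the equations of two transversal unions of lines contains every form of
degree `n` as soon as it contains forms of degree `n` separating the intersection points. -/
lemma mem_of_separated {A B : Finset ℂ} (hAB : Disjoint A B) {I : Ideal (MvPolynomial (Fin 3) ℂ)}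
    (hA : lines A ∈ I) (hB : lines B ∈ I) {n : ℕ}
    (hp : ∀ a ∈ A, ∀ b ∈ B, ∃ p ∈ I, p.IsHomogeneous n ∧ eval (node a b) p ≠ 0 ∧
      ∀ a' ∈ A, ∀ b' ∈ B, a' ≠ a ∨ b' ≠ b → eval (node a' b') p = 0)
    {h : MvPolynomial (Fin 3) ℂ} (hh : h.IsHomogeneous n) : h ∈ I := by
  choose! p hpI hpn hp0 hp1 using hp
  set s : MvPolynomial (Fin 3) ℂ := ∑ x ∈ A ×ˢ B,
    C (eval (node x.1 x.2) h / eval (node x.1 x.2) (p x.1 x.2)) * p x.1 x.2 with hs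
  have hsn : s.IsHomogeneous n := IsHomogeneous.sum _ _ _ fun x hx => by
    obtain ⟨hx1, hx2⟩ := Finset.mem_product.mp hx
    exact (hpn _ hx1 _ hx2).C_mul _
  have hsI : s ∈ I := I.sum_mem fun x hx => by
    obtain ⟨hx1, hx2⟩ := Finset.mem_product.mp hx
    exact I.mul_mem_left _ (hpI _ hx1 _ hx2)
  obtain ⟨u, v, huv⟩ := exists_eq_lines_lines (p := h - s) hAB fun a ha b hb => by
    refine vanishesAt_of_isHomogeneous (hh.sub hsn) ?_
    rw [map_sub, hs, map_sum, Finset.sum_eq_single (a, b)]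
    · rw [map_mul, eval_C, div_mul_cancel₀ _ (hp0 a ha b hb), sub_self]
    · rintro ⟨a', b'⟩ hx hne
      obtain ⟨hx1, hx2⟩ := Finset.mem_product.mp hx
      rw [map_mul, hp1 a' hx1 b' hx2 a ha b hb, mul_zero]
      by_contra! h'
      exact hne (by rw [h'.1, h'.2])
    · exact fun hx => absurd (Finset.mk_mem_product ha hb) hx
  rw [← sub_add_cancel h s, huv]
  exact I.add_mem (I.add_mem (I.mul_mem_left _ hA) (I.mul_mem_left _ hB)) hsI

/-- The derivative in the direction of the vector `w`. -/
noncomputable def dirDeriv (w : Fin 3 → ℂ) :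
    Derivation ℂ (MvPolynomial (Fin 3) ℂ) (MvPolynomial (Fin 3) ℂ) :=
  ∑ k, w k • pderiv k

lemma dirDeriv_apply (w : Fin 3 → ℂ) (p : MvPolynomial (Fin 3) ℂ) :
    dirDeriv w p = ∑ k, C (w k) * pderiv k p := by
  simp [dirDeriv, Fin.sum_univ_three, smul_eq_C_mul]

lemma dirDeriv_mul (w : Fin 3 → ℂ) (p q : MvPolynomial (Fin 3) ℂ) :
    dirDeriv w (p * q) = p * dirDeriv w q + q * dirDeriv w p := by
  rw [Derivation.leibniz, smul_eq_mul, smul_eq_mul]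

lemma dirDeriv_line (w : Fin 3 → ℂ) (c : ℂ) :
    dirDeriv w (line c) = C (w 0 + c * w 1 + c ^ 2 * w 2) := by
  simp [dirDeriv_apply, line, Fin.sum_univ_three, pderiv_X, Pi.single_apply]
  ring

lemma isHomogeneous_dirDeriv (w : Fin 3 → ℂ) {p : MvPolynomial (Fin 3) ℂ} {n : ℕ}
    (hp : p.IsHomogeneous n) : (dirDeriv w p).IsHomogeneous (n - 1) := by
  rw [dirDeriv_apply]
  exact IsHomogeneous.sum _ _ _ fun k _ => (hp.pderiv).C_mul _

lemma dirDeriv_lines {A : Finset ℂ} {a : ℂ} (ha : a ∈ A) (w : Fin 3 → ℂ) :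
    dirDeriv w (lines A) = line a * dirDeriv w (lines (A.erase a)) +
      lines (A.erase a) * C (w 0 + a * w 1 + a ^ 2 * w 2) := by
  rw [lines_eq_mul_erase ha, dirDeriv_mul, dirDeriv_line]

lemma eval_node_dirDeriv_lines {A : Finset ℂ} {a : ℂ} (ha : a ∈ A) (w : Fin 3 → ℂ) (b : ℂ) :
    eval (node b a) (dirDeriv w (lines A)) =
      eval (node b a) (lines (A.erase a)) * (w 0 + a * w 1 + a ^ 2 * w 2) := by
  rw [dirDeriv_lines ha, map_add, map_mul, map_mul, eval_node_line, sub_self, mul_zero, zero_mul,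
    zero_add, eval_C]

/-- The expansion of `lines (A.erase c) * q * dirDeriv w (lines B)` in the basis `nodeBasis`,
modulo the equations of `A` and `B`. -/
lemma lines_erase_mul_dirDeriv_sub_mem {A B : Finset ℂ} (hAB : Disjoint A B)
    {I : Ideal (MvPolynomial (Fin 3) ℂ)} (hA : lines A ∈ I) (hB : lines B ∈ I) (c : ℂ)
    {s : ℕ} {q : MvPolynomial (Fin 3) ℂ} (hq : q.IsHomogeneous s) (w : Fin 3 → ℂ) :
    lines (A.erase c) * q * dirDeriv w (lines B) - ∑ m ∈ B,
      C (eval (node c m) q * (w 0 + m * w 1 + m ^ 2 * w 2)) * nodeBasis A B s c m ∈ I := by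
  have hfac : lines (A.erase c) * q * dirDeriv w (lines B) - ∑ m ∈ B,
      C (eval (node c m) q * (w 0 + m * w 1 + m ^ 2 * w 2)) * nodeBasis A B s c m =
      (q * dirDeriv w (lines B) - ∑ m ∈ B,
        C (eval (node c m) q * (w 0 + m * w 1 + m ^ 2 * w 2)) * (lines (B.erase m) * X 2 ^ s)) *
        lines (A.erase c) := by
    rw [sub_mul, Finset.sum_mul]
    congr 1
    · ring
    · exact Finset.sum_congr rfl fun m _ => by rw [nodeBasis]; ring
  rw [hfac]
  set p := q * dirDeriv w (lines B) - ∑ m ∈ B,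
    C (eval (node c m) q * (w 0 + m * w 1 + m ^ 2 * w 2)) * (lines (B.erase m) * X 2 ^ s) with hp
  have hpn : p.IsHomogeneous (s + (B.card - 1)) := by
    refine (hq.mul (isHomogeneous_dirDeriv w (isHomogeneous_lines B))).sub
      (IsHomogeneous.sum _ _ _ fun m hm => IsHomogeneous.C_mul ?_ _)
    have := (isHomogeneous_lines (B.erase m)).mul (isHomogeneous_X_pow (R := ℂ) (2 : Fin 3) s)
    rwa [Finset.card_erase_of_mem hm, add_comm] at this
  obtain ⟨u, v, huv⟩ := exists_eq_lines_lines (p := p * lines (A.erase c)) hAB fun a ha b hb => by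
    by_cases hac : a = c
    · subst hac
      rw [mul_comm]
      refine (vanishesAt_of_isHomogeneous hpn ?_).mul_left _
      rw [hp, map_sub, map_sum, map_mul, eval_node_dirDeriv_lines hb, Finset.sum_eq_single b]
      · simp only [map_mul, eval_C, eval_node_X_two_pow]
        ring
      · intro m hm hmb
        have h0 : eval (node a b) (lines (B.erase m)) = 0 :=
          eval_node_lines_eq_zero (Or.inr (Finset.mem_erase.mpr ⟨hmb.symm, hb⟩))
        simp only [map_mul, h0, zero_mul, mul_zero]
      · exact fun h => absurd hb h
    · exact (vanishesAt_lines (Or.inl (Finset.mem_erase.mpr ⟨hac, ha⟩))).mul_left _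
  rw [huv]
  exact I.add_mem (I.mul_mem_left _ hA) (I.mul_mem_left _ hB)

end TangentLines

/-! ### Ideals containing the partial derivatives of a diagonal quadric -/

namespace BigradedRing
open TangentLines

/-- The inclusion of `ℂ[x₀, x₁, x₂]` in `S`. -/
noncomputable abbrev incl : MvPolynomial (Fin 3) ℂ →ₐ[ℂ] S := rename Sum.inl

/-- The variable `y_i`. -/
noncomputable abbrev Y (i : Fin 4) : S := X (Sum.inr i)

/-- The polynomials `p` in `x₀, x₁, x₂` with `p * M ∈ J`. -/
noncomputable def xColon (J : Ideal S) (M : S) : Ideal (MvPolynomial (Fin 3) ℂ) where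
  carrier := {p | incl p * M ∈ J}
  add_mem' {p q} hp hq := by
    simp only [Set.mem_ofPred_eq, map_add, add_mul] at *
    exact J.add_mem hp hq
  zero_mem' := by simp
  smul_mem' c p hp := by
    simp only [Set.mem_ofPred_eq, smul_eq_mul, map_mul, mul_assoc] at *
    exact J.mul_mem_left _ hp

lemma mem_xColon {J : Ideal S} {M : S} {p : MvPolynomial (Fin 3) ℂ} :
    p ∈ xColon J M ↔ incl p * M ∈ J := Iff.rfl

/-- The ideal `J` contains the partial derivatives of `∑ i, a_i * y_i ^ 2`, where `a_i` is the
equation of the union of the lines in `A i`; the sets `A i` are pairwise disjoint. The derivative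
with respect to `y_i` is `a_i * y_i`, up to a factor `2`. -/
structure ContainsPartials (A : Fin 4 → Finset ℂ) (J : Ideal S) : Prop where
  disjoint : ∀ i j, i ≠ j → Disjoint (A i) (A j)
  lines_mul_mem : ∀ i, incl (lines (A i)) * Y i ∈ J
  sum_pderiv_mem : ∀ k, ∑ j, incl (pderiv k (lines (A j))) * Y j ^ 2 ∈ J

namespace ContainsPartials

variable {A : Fin 4 → Finset ℂ} {J : Ideal S}

lemma lines_mem (H : ContainsPartials A J) {M : S} {i : Fin 4} (h : Y i ∣ M) :
    lines (A i) ∈ xColon J M := by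
  obtain ⟨M, rfl⟩ := h
  rw [mem_xColon, ← mul_assoc]
  exact J.mul_mem_right _ (H.lines_mul_mem i)

lemma mem_of_card_eq_zero (H : ContainsPartials A J) {M : S} {i : Fin 4} (h : Y i ∣ M)
    (hi : (A i).card = 0) (p : MvPolynomial (Fin 3) ℂ) : p ∈ xColon J M := by
  have h1 := H.lines_mem h
  rw [Finset.card_eq_zero.mp hi] at h1
  have h2 := (xColon J M).mul_mem_left p h1
  simpa [lines] using h2

lemma sum_dirDeriv_mem (H : ContainsPartials A J) (w : Fin 3 → ℂ) :
    ∑ j, incl (dirDeriv w (lines (A j))) * Y j ^ 2 ∈ J := by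
  have h : ∑ j, incl (dirDeriv w (lines (A j))) * Y j ^ 2 =
      ∑ k, incl (C (w k)) * ∑ j, incl (pderiv k (lines (A j))) * Y j ^ 2 := by
    simp only [dirDeriv_apply, map_sum, map_mul, Finset.sum_mul, Finset.mul_sum]
    rw [Finset.sum_comm]
    simp only [mul_assoc]
  rw [h]
  exact J.sum_mem fun k _ => J.mul_mem_left _ (H.sum_pderiv_mem k)

lemma sum_mul_dirDeriv_mem (H : ContainsPartials A J) (w : Fin 3 → ℂ)
    (q : MvPolynomial (Fin 3) ℂ) (M : S) :
    ∑ j, incl (q * dirDeriv w (lines (A j))) * (M * Y j ^ 2) ∈ J := by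
  have h := J.mul_mem_left (incl q * M) (H.sum_dirDeriv_mem w)
  rw [Finset.mul_sum] at h
  convert h using 2 with j
  rw [map_mul]
  ring

/-- Forms of large degree times `y_i * y_j * y_k` with three different indices: modulo `a_j` and
`a_k` they are multiples of `a_i`. -/
lemma mem_of_distinct (H : ContainsPartials A J) {i j k : Fin 4} (hij : i ≠ j) (hik : i ≠ k)
    (hjk : j ≠ k) {M : S} (hi : Y i ∣ M) (hj : Y j ∣ M) (hk : Y k ∣ M) {n : ℕ}
    (hn : (A i).card + (A j).card + (A k).card ≤ n + 2) {h : MvPolynomial (Fin 3) ℂ}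
    (hh : h.IsHomogeneous n) : h ∈ xColon J M := by
  refine mem_of_separated (H.disjoint j k hjk) (H.lines_mem hj) (H.lines_mem hk) ?_ hh
  intro a ha b hb
  have h1 := Finset.card_pos.mpr ⟨a, ha⟩
  have h2 := Finset.card_pos.mpr ⟨b, hb⟩
  refine ⟨nodeBasis (A j) (A k) (n + 2 - ((A i).card + (A j).card + (A k).card)) a b *
    lines (A i), (xColon J M).mul_mem_left _ (H.lines_mem hi), ?_, ?_, ?_⟩
  · have h3 := (isHomogeneous_nodeBasis (n := n - (A i).card) ha hb
      (s := n + 2 - ((A i).card + (A j).card + (A k).card)) (by omega)).mul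
      (isHomogeneous_lines (A i))
    rwa [Nat.sub_add_cancel (by omega)] at h3
  · rw [map_mul]
    exact mul_ne_zero (eval_nodeBasis_ne_zero (H.disjoint j k hjk) ha hb)
      (eval_node_lines_ne_zero (fun h => Finset.disjoint_left.mp (H.disjoint i j hij) h ha)
        fun h => Finset.disjoint_left.mp (H.disjoint i k hik) h hb)
  · intro a' ha' b' hb' hne
    rw [map_mul, eval_nodeBasis_of_ne ha' hb' hne, zero_mul]

end ContainsPartials

end BigradedRing

/-! ### Monomials with at least two different indices -/

namespace BigradedRing
open TangentLines

/-- The indices of the four variables `y_i`, listed so that two given ones come first. -/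
lemma sum_eq_of_ne {i j : Fin 4} (hij : i ≠ j) : ∃ k l, k ≠ i ∧ k ≠ j ∧ l ≠ i ∧ l ≠ j ∧ k ≠ l ∧
    (∀ m, m = i ∨ m = j ∨ m = k ∨ m = l) ∧
    ∀ {R : Type} [AddCommMonoid R] (φ : Fin 4 → R), ∑ m, φ m = φ i + φ j + φ k + φ l := by
  have h : ∀ i j : Fin 4, i ≠ j → ∃ k l, k ≠ i ∧ k ≠ j ∧ l ≠ i ∧ l ≠ j ∧ k ≠ l ∧
      Finset.univ = ({i, j, k, l} : Finset (Fin 4)) := by decide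
  obtain ⟨k, l, h1, h2, h3, h4, h5, hu⟩ := h i j hij
  refine ⟨k, l, h1, h2, h3, h4, h5, fun m => ?_, fun φ => ?_⟩
  · have hm := Finset.mem_univ m
    rw [hu] at hm
    simpa using hm
  rw [hu, Finset.sum_insert (by simp [hij, h1.symm, h3.symm]),
    Finset.sum_insert (by simp [h2.symm, h4.symm]), Finset.sum_insert (by simp [h5]),
    Finset.sum_singleton]
  simp only [add_assoc]

namespace ContainsPartials

variable {A : Fin 4 → Finset ℂ} {J : Ideal S}

/-- Forms times `y_i ^ 3 * y_j`: a derivative in a direction contained in the line `m` separates the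
points on this line. -/
lemma mem_of_cube (H : ContainsPartials A J) {d N : ℕ} {r : Fin 4 → ℕ}
    (hd : ∀ i, (A i).card = d + 2 * r i) (hN : ∑ i, (A i).card = 2 * N) {i j : Fin 4}
    (hij : i ≠ j) {n : ℕ} (hn : 2 * n + 6 = 2 * N + 3 * (A i).card + (A j).card)
    {h : MvPolynomial (Fin 3) ℂ} (hh : h.IsHomogeneous n) : h ∈ xColon J (Y i ^ 3 * Y j) := by
  have hi : Y i ∣ Y i ^ 3 * Y j := ⟨Y i ^ 2 * Y j, by ring⟩
  have hj : Y j ∣ Y i ^ 3 * Y j := ⟨Y i ^ 3, by ring⟩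
  refine mem_of_separated (H.disjoint i j hij) (H.lines_mem hi) (H.lines_mem hj) ?_ hh
  intro c hc m hm
  have hcm : c ≠ m := fun h => Finset.disjoint_left.mp (H.disjoint i j hij) hc (h ▸ hm)
  have h1 := Finset.card_pos.mpr ⟨c, hc⟩
  have h2 := Finset.card_pos.mpr ⟨m, hm⟩
  set w : Fin 3 → ℂ := ![-m, 1, 0] with hw
  have hwL : ∀ a : ℂ, w 0 + a * w 1 + a ^ 2 * w 2 = a - m := fun a => by simp [hw]; ring
  obtain ⟨k, l, hki, hkj, hli, hlj, hkl, -, hsum⟩ := sum_eq_of_ne hij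
  have hdi := hd i
  have hdj := hd j
  have hdk := hd k
  have hdl := hd l
  rw [hsum] at hN
  set s := n + 1 + 2 - ((A i).card + (A i).card + (A j).card) with hs
  set q := nodeBasis (A i) (A j) s c m with hq
  have hqn : q.IsHomogeneous (n + 1 - (A i).card) := isHomogeneous_nodeBasis hc hm (by omega)
  have hthird : ∀ k l, k ≠ i → k ≠ j → (A i).card + (A j).card + (A k).card + (A l).card = 2 * N →
      (A k).card = d + 2 * r k → (A l).card = d + 2 * r l →
      incl (q * dirDeriv w (lines (A k))) * (Y i * Y j * Y k ^ 2) ∈ J := by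
    intro k l hki hkj hN hdk hdl
    have hk : Y k ∣ Y i * Y j * Y k ^ 2 := ⟨Y i * Y j * Y k, by ring⟩
    rcases Nat.eq_zero_or_pos (A k).card with h0 | h0
    · exact H.mem_of_card_eq_zero hk h0 _
    · exact H.mem_of_distinct hij hki.symm hkj.symm ⟨Y j * Y k ^ 2, by ring⟩
        ⟨Y i * Y k ^ 2, by ring⟩ hk (n := n + 1 - (A i).card + ((A k).card - 1)) (by omega)
        (hqn.mul (isHomogeneous_dirDeriv w (isHomogeneous_lines _)))
  refine ⟨q * dirDeriv w (lines (A i)), ?_, ?_, ?_, ?_⟩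
  · have hmem := H.sum_mul_dirDeriv_mem w q (Y i * Y j)
    rw [hsum] at hmem
    have hjmem : incl (q * dirDeriv w (lines (A j))) * (Y i * Y j * Y j ^ 2) ∈ J := by
      -- On the line `m` the derivative of its own equation vanishes.
      refine (mem_xColon (p := q * dirDeriv w (lines (A j)))).mp ?_
      rw [dirDeriv_lines hm, hwL, sub_self, C_0, mul_zero, add_zero]
      have : q * (line m * dirDeriv w (lines ((A j).erase m))) =
          (lines ((A i).erase c) * X 2 ^ s * dirDeriv w (lines ((A j).erase m))) *
            lines (A j) := by
        rw [hq, nodeBasis, lines_eq_mul_erase hm]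
        ring
      rw [this]
      exact Ideal.mul_mem_left _ _ (H.lines_mem ⟨Y i * Y j ^ 2, by ring⟩)
    have h3 := (J.add_mem_iff_left (hthird l k hli hlj (by omega) hdl hdk)).mp hmem
    have h4 := (J.add_mem_iff_left (hthird k l hki hkj (by omega) hdk hdl)).mp h3
    have h5 := (J.add_mem_iff_left hjmem).mp h4
    rw [mem_xColon]
    convert h5 using 2
    ring
  · have h3 := hqn.mul (isHomogeneous_dirDeriv w (isHomogeneous_lines (A i)))
    have h4 : n + 1 - (A i).card + ((A i).card - 1) = n := by omega
    rwa [h4] at h3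
  · rw [map_mul, node_comm, eval_node_dirDeriv_lines hc, hwL]
    refine mul_ne_zero ?_ (mul_ne_zero ?_ (sub_ne_zero.mpr hcm))
    · rw [node_comm]
      exact eval_nodeBasis_ne_zero (H.disjoint i j hij) hc hm
    · refine eval_node_lines_ne_zero (fun h => ?_) (by simp)
      exact Finset.disjoint_left.mp (H.disjoint i j hij) (Finset.mem_of_mem_erase h) hm
  · intro a' ha' b' hb' hne
    rw [map_mul, eval_nodeBasis_of_ne ha' hb' hne, zero_mul]

/-- Forms times `y_i ^ 2 * y_j ^ 2`. A linear form on `S` vanishing on `J` is determined on these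
polynomials by a symmetric function on the nodes, and the derivatives of `∑ i, a_i * y_i ^ 2` in
the directions contained in the line `c` say that the moments of this function vanish. -/
lemma mem_of_squares (H : ContainsPartials A J) {N : ℕ} (hN : ∑ i, (A i).card = 2 * N)
    {col : ℂ → Fin 4} (hcol : ∀ i, ∀ c ∈ A i, col c = i)
    (hgood : BivariateInterpolation.MonochromaticDetermining col (Finset.univ.biUnion A) id (N - 2))
    {i j : Fin 4} (hij : i ≠ j) {n : ℕ} (hn : n + 3 = N + (A i).card + (A j).card)
    {h : MvPolynomial (Fin 3) ℂ} (hh : h.IsHomogeneous n) :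
    h ∈ xColon J (Y i ^ 2 * Y j ^ 2) := by
  have hl : ∀ i j, lines (A i) ∈ xColon J (Y i ^ 2 * Y j ^ 2) := fun i j =>
    H.lines_mem ⟨Y i * Y j ^ 2, by ring⟩
  have hr : ∀ i j, lines (A j) ∈ xColon J (Y i ^ 2 * Y j ^ 2) := fun i j =>
    H.lines_mem ⟨Y i ^ 2 * Y j, by ring⟩
  refine mem_of_separated (H.disjoint i j hij) (hl i j) (hr i j) ?_ hh
  intro c hc m hm
  have hcZ : ∀ {i : Fin 4} {c : ℂ}, c ∈ A i → c ∈ Finset.univ.biUnion A := fun {i c} hc =>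
    Finset.mem_biUnion.mpr ⟨i, Finset.mem_univ i, hc⟩
  have hZ : (Finset.univ.biUnion A).card = 2 * N := by
    rw [Finset.card_biUnion fun i _ j _ hij => H.disjoint i j hij, hN]
  have hNpos : 0 < N := by
    have := Finset.card_pos.mpr ⟨c, hcZ hc⟩
    omega
  obtain ⟨s, rfl⟩ : ∃ s, N = s + 1 := ⟨N - 1, by omega⟩
  refine ⟨nodeBasis (A i) (A j) s c m, ?_, isHomogeneous_nodeBasis hc hm (by omega),
    eval_nodeBasis_ne_zero (H.disjoint i j hij) hc hm,
    fun a' ha' b' hb' hne => eval_nodeBasis_of_ne ha' hb' hne⟩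
  by_contra hnot
  obtain ⟨lam, hlam0, hlam⟩ := Submodule.exists_le_ker_of_notMem
    (p := J.restrictScalars ℂ) (v := incl (nodeBasis (A i) (A j) s c m) * (Y i ^ 2 * Y j ^ 2)) hnot
  have hlamJ : ∀ p ∈ J, lam p = 0 := fun p hp => hlam hp
  have hlamC : ∀ (a : ℂ) (p : MvPolynomial (Fin 3) ℂ) (M : S),
      lam (incl (C a * p) * M) = a * lam (incl p * M) := fun a p M => by
    rw [← smul_eq_C_mul, map_smul, smul_mul_assoc, map_smul, smul_eq_mul]
  set φ : ℂ → ℂ → ℂ := fun c m => if col c = col m then 0 else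
    lam (incl (nodeBasis (A (col c)) (A (col m)) s c m) * (Y (col c) ^ 2 * Y (col m) ^ 2)) with hφ
  have hsymm : ∀ c m, φ c m = φ m c := fun c m => by
    simp only [hφ, eq_comm (a := col c), nodeBasis]
    rw [mul_comm (Y (col c) ^ 2), mul_comm (lines ((A (col c)).erase c))]
  have hmono : ∀ c m, col c = col m → φ c m = 0 := fun c m h => if_pos h
  have hrel : ∀ i, ∀ c ∈ A i, ∀ w : Fin 3 → ℂ, w 0 + c * w 1 + c ^ 2 * w 2 = 0 →
      ∀ q : MvPolynomial (Fin 3) ℂ, q.IsHomogeneous s →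
      ∑ m ∈ Finset.univ.biUnion A,
        eval (node c m) q * (w 0 + m * w 1 + m ^ 2 * w 2) * φ c m = 0 := by
    intro i c hc w hw q hq
    rw [Finset.sum_biUnion fun i _ j _ hij => H.disjoint i j hij,
      ← hlamJ _ (H.sum_mul_dirDeriv_mem w (lines ((A i).erase c) * q) (Y i ^ 2)), map_sum]
    refine Finset.sum_congr rfl fun j _ => ?_
    rcases eq_or_ne i j with rfl | hij
    · rw [Finset.sum_eq_zero fun m hm => by
        rw [hmono c m ((hcol i c hc).trans (hcol i m hm).symm), mul_zero]]
      refine (hlamJ _ ?_).symm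
      rw [dirDeriv_lines hc, hw, C_0, mul_zero, add_zero, ← mem_xColon]
      have : lines ((A i).erase c) * q * (line c * dirDeriv w (lines ((A i).erase c))) =
          q * dirDeriv w (lines ((A i).erase c)) * lines (A i) := by
        rw [lines_eq_mul_erase hc]
        ring
      rw [this]
      exact Ideal.mul_mem_left _ _ (hl i i)
    · have h1 := hlamJ _ (mem_xColon.mp (lines_erase_mul_dirDeriv_sub_mem (H.disjoint i j hij)
        (hl i j) (hr i j) c hq w))
      rw [map_sub, sub_mul, map_sub, sub_eq_zero, map_sum, Finset.sum_mul, map_sum] at h1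
      rw [h1]
      refine Finset.sum_congr rfl fun m hm => ?_
      rw [hlamC, hφ]
      dsimp only
      rw [hcol i c hc, hcol j m hm, if_neg hij]
  have hzero := BivariateInterpolation.eq_zero_of_symmetric_of_moments col
    (Finset.univ.biUnion A) (s + 1) hZ hgood φ (fun c _ m _ => hsymm c m)
    (fun c _ m _ _ => hmono c m) (by
      intro c hcZ k hk
      obtain ⟨i, -, hc⟩ := Finset.mem_biUnion.mp hcZ
      have hφcc : φ c c = 0 := hmono c c rfl
      rw [Finset.sum_erase _ (by rw [hφcc, mul_zero])]
      -- On the points of the line `c` the quotient `-(x₁ + c x₂) / x₂` is the other parameter.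
      have hq : ∀ k ≤ s, ((C (-1) * X 1 + C (-c) * X 2) ^ k * X 2 ^ (s - k) :
          MvPolynomial (Fin 3) ℂ).IsHomogeneous s := fun k hk => by
        have h1 : ((C (-1) * X 1 + C (-c) * X 2 : MvPolynomial (Fin 3) ℂ)).IsHomogeneous 1 :=
          (isHomogeneous_C_mul_X _ _).add (isHomogeneous_C_mul_X _ _)
        have h2 := (h1.pow k).mul (isHomogeneous_X_pow (R := ℂ) (2 : Fin 3) (s - k))
        rwa [one_mul, Nat.add_sub_cancel' hk] at h2
      have hqv : ∀ (k : ℕ) (m : ℂ), eval (node c m) ((C (-1) * X 1 + C (-c) * X 2) ^ k *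
          X 2 ^ (s - k) : MvPolynomial (Fin 3) ℂ) = m ^ k := fun k m => by
        simp [node]
      rcases Nat.lt_or_ge s k with hks | hks
      · obtain rfl : k = s + 1 := by omega
        have := hrel i c hc ![0, -c, 1] (by simp; ring) _ (hq s le_rfl)
        rw [← this]
        refine Finset.sum_congr rfl fun m _ => ?_
        rw [hqv]
        simp only [Matrix.cons_val]
        ring
      · have := hrel i c hc ![-c, 1, 0] (by simp) _ (hq k hks)
        rw [← this]
        refine Finset.sum_congr rfl fun m _ => ?_
        rw [hqv]
        simp only [Matrix.cons_val]
        ring)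
  have hcm : c ≠ m := fun h => Finset.disjoint_left.mp (H.disjoint i j hij) hc (h ▸ hm)
  have h1 := hzero c (hcZ hc) m (hcZ hm) hcm
  simp only [hφ, hcol i c hc, hcol j m hm, if_neg hij] at h1
  exact hlam0 h1

end ContainsPartials

end BigradedRing

/-! ### Fourth powers -/

namespace BigradedRing
open TangentLines

/-- The polynomial `∑ i, x₂ ^ (N + |A i| - 3) * y_i ^ 2`, the sum being over the indices for which
`A i` has double points: for these the exponent is not truncated, provided that `N` is positive. -/
noncomputable def powerQuadric (A : Fin 4 → Finset ℂ) (N : ℕ) : S :=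
  ∑ i with 2 ≤ (A i).card, incl (X 2 ^ (N + (A i).card - 3)) * Y i ^ 2

namespace ContainsPartials

variable {A : Fin 4 → Finset ℂ} {J : Ideal S}

/-- A multiple of a derivative of `∑ j, a_j * y_j ^ 2` by `y_i ^ 2`, in which the terms with
`y_i ^ 2 * y_j ^ 2` for `j ≠ i` are already known to be in `J`. -/
lemma mul_dirDeriv_mem (H : ContainsPartials A J) {N : ℕ} {i : Fin 4}
    (hsq : ∀ j, i ≠ j → ∀ n (h : MvPolynomial (Fin 3) ℂ), n + 3 = N + (A i).card + (A j).card →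
      h.IsHomogeneous n → h ∈ xColon J (Y i ^ 2 * Y j ^ 2))
    (w : Fin 3 → ℂ) {k : ℕ} (hk : k + 2 = N + (A i).card) {q : MvPolynomial (Fin 3) ℂ}
    (hq : q.IsHomogeneous k) : q * dirDeriv w (lines (A i)) ∈ xColon J (Y i ^ 4) := by
  have hsum := H.sum_mul_dirDeriv_mem w q (Y i ^ 2)
  rw [← Finset.add_sum_erase _ _ (Finset.mem_univ i)] at hsum
  have hrest : ∑ j ∈ Finset.univ.erase i,
      incl (q * dirDeriv w (lines (A j))) * (Y i ^ 2 * Y j ^ 2) ∈ J := by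
    refine J.sum_mem fun j hj => ?_
    rw [← mem_xColon]
    rcases Nat.eq_zero_or_pos (A j).card with h0 | h0
    · exact H.mem_of_card_eq_zero (i := j) ⟨Y i ^ 2 * Y j, by ring⟩ h0 _
    · exact hsq j (Finset.ne_of_mem_erase hj).symm (k + ((A j).card - 1)) _ (by omega)
        (hq.mul (isHomogeneous_dirDeriv w (isHomogeneous_lines _)))
  have h := (J.add_mem_iff_left hrest).mp hsum
  rw [mem_xColon]
  convert h using 2
  ring

/-- Multiples of the square of the equation of all lines but one, times `y_i ^ 4`. -/
lemma mul_lines_erase_sq_mem (H : ContainsPartials A J) {N : ℕ} {i : Fin 4}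
    (hsq : ∀ j, i ≠ j → ∀ n (h : MvPolynomial (Fin 3) ℂ), n + 3 = N + (A i).card + (A j).card →
      h.IsHomogeneous n → h ∈ xColon J (Y i ^ 2 * Y j ^ 2))
    {c : ℂ} (hc : c ∈ A i) {s : ℕ} (hs : s + 1 = N) {v : MvPolynomial (Fin 3) ℂ}
    (hv : v.IsHomogeneous s) : v * lines ((A i).erase c) ^ 2 ∈ xColon J (Y i ^ 4) := by
  have hpos := Finset.card_pos.mpr ⟨c, hc⟩
  have hq := hv.mul (isHomogeneous_lines ((A i).erase c))
  rw [Finset.card_erase_of_mem hc] at hq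
  have h := H.mul_dirDeriv_mem hsq ![1, 0, 0] (by omega) hq
  rw [dirDeriv_lines hc] at h
  have hmul : v * dirDeriv ![1, 0, 0] (lines ((A i).erase c)) * lines (A i) ∈
      xColon J (Y i ^ 4) :=
    Ideal.mul_mem_left _ _ (H.lines_mem ⟨Y i ^ 3, by ring⟩)
  convert Ideal.sub_mem _ h hmul using 1
  rw [lines_eq_mul_erase hc]
  simp only [Matrix.cons_val, mul_zero, add_zero, C_1]
  ring

/-- The forms `lines (((A i).erase c).erase c') * x₂ ^ N` separate the points of the line `c`; their
multiples by the equation of the other lines, times `y_i ^ 4`, come from the derivative in a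
direction contained in the line `c'`. -/
lemma lines_erase_erase_mul_mem (H : ContainsPartials A J) {N : ℕ} {i : Fin 4}
    (hsq : ∀ j, i ≠ j → ∀ n (h : MvPolynomial (Fin 3) ℂ), n + 3 = N + (A i).card + (A j).card →
      h.IsHomogeneous n → h ∈ xColon J (Y i ^ 2 * Y j ^ 2))
    {c c' : ℂ} (hc : c ∈ A i) (hc' : c' ∈ (A i).erase c) :
    lines (((A i).erase c).erase c') * X 2 ^ N * lines ((A i).erase c) ∈ xColon J (Y i ^ 4) := by
  have hpos := Finset.card_pos.mpr ⟨c', hc'⟩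
  have hq := (isHomogeneous_lines (((A i).erase c).erase c')).mul
    (isHomogeneous_X_pow (R := ℂ) (2 : Fin 3) N)
  rw [Finset.card_erase_of_mem hc'] at hq
  rw [Finset.card_erase_of_mem hc] at hq hpos
  have h := H.mul_dirDeriv_mem hsq ![-c', 1, 0] (by omega) hq
  have hne : c - c' ≠ 0 := sub_ne_zero.mpr (Finset.ne_of_mem_erase hc').symm
  rw [dirDeriv_lines hc, dirDeriv_lines hc'] at h
  have hmul : X 2 ^ N * dirDeriv ![-c', 1, 0] (lines (((A i).erase c).erase c')) * lines (A i) ∈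
      xColon J (Y i ^ 4) :=
    Ideal.mul_mem_left _ _ (H.lines_mem ⟨Y i ^ 3, by ring⟩)
  have hdiff := Ideal.mul_mem_left _ (C (c - c')⁻¹) (Ideal.sub_mem _ h hmul)
  convert hdiff using 1
  have hinv : (C (c - c')⁻¹ * (C c - C c') : MvPolynomial (Fin 3) ℂ) = 1 := by
    rw [← C_sub, ← C_mul, inv_mul_cancel₀ hne, C_1]
  rw [lines_eq_mul_erase hc, lines_eq_mul_erase hc']
  simp only [Matrix.cons_val, mul_zero, add_zero, mul_one, C_add, C_neg]
  linear_combination (-lines (((A i).erase c).erase c') ^ 2 * X 2 ^ N * line c') * hinv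

/-- Multiples of the equation of all lines but one, times `y_i ^ 4`. -/
lemma mul_lines_erase_mem (H : ContainsPartials A J) {N : ℕ} {i : Fin 4} (hNpos : 0 < N)
    (hi : 2 ≤ (A i).card)
    (hsq : ∀ j, i ≠ j → ∀ n (h : MvPolynomial (Fin 3) ℂ), n + 3 = N + (A i).card + (A j).card →
      h.IsHomogeneous n → h ∈ xColon J (Y i ^ 2 * Y j ^ 2))
    {c : ℂ} (hc : c ∈ A i) {k : ℕ} (hk : k + 2 = N + (A i).card) {p : MvPolynomial (Fin 3) ℂ}
    (hp : p.IsHomogeneous k) : p * lines ((A i).erase c) ∈ xColon J (Y i ^ 4) := by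
  set B := (A i).erase c with hB
  have hcB : B.card = (A i).card - 1 := Finset.card_erase_of_mem hc
  set κ : ℂ → ℂ := fun c' => eval (node c c') p / eval (node c c') (lines (B.erase c')) with hκ
  set q := ∑ c' ∈ B, C (κ c') * (lines (B.erase c') * X 2 ^ N) with hq
  have hqn : q.IsHomogeneous k := IsHomogeneous.sum _ _ _ fun c' hc' => by
    have h1 := (isHomogeneous_lines (B.erase c')).mul
      (isHomogeneous_X_pow (R := ℂ) (2 : Fin 3) N)
    rw [Finset.card_erase_of_mem hc'] at h1
    have h2 := Finset.card_pos.mpr ⟨c', hc'⟩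
    have h3 : B.card - 1 + N = k := by omega
    rw [h3] at h1
    exact h1.C_mul _
  have hqmem : q * lines B ∈ xColon J (Y i ^ 4) := by
    rw [hq, Finset.sum_mul]
    refine Ideal.sum_mem _ fun c' hc' => ?_
    rw [mul_assoc]
    exact Ideal.mul_mem_left _ _ (H.lines_erase_erase_mul_mem hsq hc hc')
  obtain ⟨u, v, huv⟩ := exists_eq_line_lines (p := p - q) (c := c) (B := B) (by simp [hB]) (by
    intro b hb
    refine vanishesAt_of_isHomogeneous (hp.sub hqn) ?_
    have hb0 : eval (node c b) (lines (B.erase b)) ≠ 0 :=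
      eval_node_lines_ne_zero (by simp [hB]) (by simp)
    rw [map_sub, hq, map_sum, Finset.sum_eq_single b]
    · rw [map_mul, eval_C, map_mul, eval_node_X_two_pow, mul_one, hκ,
        div_mul_cancel₀ _ hb0, sub_self]
    · intro b' hb' hne
      rw [map_mul, map_mul, eval_node_lines_eq_zero
        (Or.inr (Finset.mem_erase.mpr ⟨hne.symm, hb⟩)), zero_mul, mul_zero]
    · exact fun h => absurd hb h)
  -- Only the homogeneous components of `u` and `v` of the right degrees matter.
  have hcomp : p - q = homogeneousComponent (N + (A i).card - 3) u * line c +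
      homogeneousComponent (N - 1) v * lines B := by
    have h1 : homogeneousComponent k (p - q) = p - q := by
      rw [homogeneousComponent_of_mem (hp.sub hqn), if_pos rfl]
    have h2 : homogeneousComponent k (u * line c) =
        homogeneousComponent (N + (A i).card - 3) u * line c := by
      have := weightedHomogeneousComponent_mul_right (1 : Fin 3 → ℕ) (isHomogeneous_line c) u
        (N + (A i).card - 3)
      rwa [show N + (A i).card - 3 + 1 = k by omega] at this
    have h3 : homogeneousComponent k (v * lines B) =
        homogeneousComponent (N - 1) v * lines B := by
      have := weightedHomogeneousComponent_mul_right (1 : Fin 3 → ℕ) (isHomogeneous_lines B) v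
        (N - 1)
      rwa [show N - 1 + B.card = k by omega] at this
    rw [← h1, huv, map_add, h2, h3]
  have hfin : p * lines B = q * lines B +
      (homogeneousComponent (N + (A i).card - 3) u * lines (A i) +
        homogeneousComponent (N - 1) v * lines B ^ 2) := by
    rw [lines_eq_mul_erase hc, ← hB]
    linear_combination lines B * hcomp
  rw [hfin]
  exact Ideal.add_mem _ hqmem (Ideal.add_mem _
    (Ideal.mul_mem_left _ _ (H.lines_mem ⟨Y i ^ 3, by ring⟩))
    (H.mul_lines_erase_sq_mem hsq hc (by omega) (homogeneousComponent_isHomogeneous _ _)))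

/-- Forms times `y_i ^ 4`: the values at the double points are taken care of by `g`, and the
remainder is in the ideal generated by the equations of all lines but one. -/
lemma mem_of_fourth_power (H : ContainsPartials A J) {N : ℕ} (hN : ∑ i, (A i).card = 2 * N)
    (hg : powerQuadric A N ∈ J) {i : Fin 4}
    (hsq : ∀ j, i ≠ j → ∀ n (h : MvPolynomial (Fin 3) ℂ), n + 3 = N + (A i).card + (A j).card →
      h.IsHomogeneous n → h ∈ xColon J (Y i ^ 2 * Y j ^ 2))
    {n : ℕ} (hn : n + 3 = N + 2 * (A i).card) {h : MvPolynomial (Fin 3) ℂ}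
    (hh : h.IsHomogeneous n) : h ∈ xColon J (Y i ^ 4) := by
  have hle : (A i).card ≤ 2 * N :=
    hN ▸ Finset.single_le_sum (f := fun i => (A i).card) (fun _ _ => Nat.zero_le _)
      (Finset.mem_univ i)
  rcases Nat.eq_zero_or_pos (A i).card with h0 | h0
  · exact H.mem_of_card_eq_zero ⟨Y i ^ 3, by ring⟩ h0 _
  rcases Nat.lt_or_ge (A i).card 2 with h2 | h2
  · obtain ⟨c, hc⟩ := Finset.card_eq_one.mp (show (A i).card = 1 by omega)
    have hmem := H.mul_lines_erase_sq_mem hsq (c := c) (by simp [hc]) (s := n) (by omega) hh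
    simpa [hc, lines] using hmem
  obtain ⟨q, hq, hqv⟩ := exists_interpolation_self (A := A i) (n := (A i).card) (by omega)
    fun x => eval x h
  have hqmem : q * X 2 ^ (N + (A i).card - 3) ∈ xColon J (Y i ^ 4) := by
    have hsum := J.mul_mem_left (incl q * Y i ^ 2) hg
    rw [powerQuadric, ← Finset.add_sum_erase _ _
      (Finset.mem_filter.mpr ⟨Finset.mem_univ i, h2⟩), mul_add] at hsum
    have hrest : incl q * Y i ^ 2 * ∑ j ∈ (Finset.univ.filter fun i => 2 ≤ (A i).card).erase i,
        incl (X 2 ^ (N + (A j).card - 3)) * Y j ^ 2 ∈ J := by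
      rw [Finset.mul_sum]
      refine J.sum_mem fun j hj => ?_
      obtain ⟨hji, hj⟩ := Finset.mem_erase.mp hj
      have hj2 := (Finset.mem_filter.mp hj).2
      have hm := mem_xColon.mp (hsq j hji.symm ((A i).card + (N + (A j).card - 3)) _ (by omega)
        (hq.mul (isHomogeneous_X_pow (R := ℂ) (2 : Fin 3) (N + (A j).card - 3))))
      convert hm using 1
      rw [map_mul]
      ring
    have h := (J.add_mem_iff_left hrest).mp hsum
    rw [mem_xColon]
    convert h using 1
    rw [map_mul]
    ring
  have hrn : (h - q * X 2 ^ (N + (A i).card - 3)).IsHomogeneous n := by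
    have h3 := hq.mul (isHomogeneous_X_pow (R := ℂ) (2 : Fin 3) (N + (A i).card - 3))
    rw [show (A i).card + (N + (A i).card - 3) = n by omega] at h3
    exact hh.sub h3
  obtain ⟨p, hp⟩ := exists_eq_sum_lines_erase (p := h - q * X 2 ^ (N + (A i).card - 3))
    (Finset.card_pos.mp h0) fun a ha b hb hab => vanishesAt_of_isHomogeneous hrn (by
      rw [map_sub, map_mul, eval_node_X_two_pow, hqv a ha b hb hab, mul_one, sub_self])
  have hcomp : h - q * X 2 ^ (N + (A i).card - 3) =
      ∑ a ∈ A i, homogeneousComponent (N + (A i).card - 2) (p a) * lines ((A i).erase a) := by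
    have h1 : homogeneousComponent n (h - q * X 2 ^ (N + (A i).card - 3)) =
        h - q * X 2 ^ (N + (A i).card - 3) := by
      rw [homogeneousComponent_of_mem hrn, if_pos rfl]
    rw [← h1, hp, map_sum]
    refine Finset.sum_congr rfl fun a ha => ?_
    have := weightedHomogeneousComponent_mul_right (1 : Fin 3 → ℕ)
      (isHomogeneous_lines ((A i).erase a)) (p a) (N + (A i).card - 2)
    rwa [show N + (A i).card - 2 + ((A i).erase a).card = n by
      rw [Finset.card_erase_of_mem ha]; omega] at this
  rw [← sub_add_cancel h (q * X 2 ^ (N + (A i).card - 3)), hcomp]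
  exact Ideal.add_mem _ (Ideal.sum_mem _ fun a ha => H.mul_lines_erase_mem (by omega) h2 hsq ha
    (k := N + (A i).card - 2) (by omega) (homogeneousComponent_isHomogeneous _ _)) hqmem

/-- Every product of a form in `x₀, x₁, x₂` of the right degree and four variables `y_i` is in
an ideal containing the partial derivatives and `g`. -/
theorem mem_of_isHomogeneous (H : ContainsPartials A J) {d N : ℕ} {r : Fin 4 → ℕ}
    (hd : ∀ i, (A i).card = d + 2 * r i) (hN : ∑ i, (A i).card = 2 * N)
    {col : ℂ → Fin 4} (hcol : ∀ i, ∀ c ∈ A i, col c = i)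
    (hgood : BivariateInterpolation.MonochromaticDetermining col (Finset.univ.biUnion A) id (N - 2))
    (hg : powerQuadric A N ∈ J) (i j k l : Fin 4) {n : ℕ}
    (hn : 2 * n + 6 = 2 * N + ((A i).card + (A j).card + (A k).card + (A l).card))
    {h : MvPolynomial (Fin 3) ℂ} (hh : h.IsHomogeneous n) :
    h ∈ xColon J (Y i * Y j * Y k * Y l) := by
  have hsq : ∀ i j, i ≠ j → ∀ n (h : MvPolynomial (Fin 3) ℂ),
      n + 3 = N + (A i).card + (A j).card → h.IsHomogeneous n →
      h ∈ xColon J (Y i ^ 2 * Y j ^ 2) := fun i j hij n h hn hh =>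
    H.mem_of_squares hN hcol hgood hij hn hh
  have h4 : ∀ i, 2 * n + 6 = 2 * N + 4 * (A i).card → h ∈ xColon J (Y i ^ 4) := fun i hn =>
    H.mem_of_fourth_power hN hg (hsq i) (by omega) hh
  have h31 : ∀ i j, i ≠ j → 2 * n + 6 = 2 * N + 3 * (A i).card + (A j).card →
      h ∈ xColon J (Y i ^ 3 * Y j) := fun i j hij hn => H.mem_of_cube hd hN hij hn hh
  have h22 : ∀ i j, i ≠ j → 2 * n + 6 = 2 * N + 2 * (A i).card + 2 * (A j).card →
      h ∈ xColon J (Y i ^ 2 * Y j ^ 2) := fun i j hij hn =>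
    hsq i j hij n h (by omega) hh
  have h3 : ∀ i j k l, i ≠ j → i ≠ k → j ≠ k →
      2 * n + 6 = 2 * N + (A i).card + (A j).card + (A k).card + (A l).card →
      h ∈ xColon J (Y i * Y j * Y k * Y l) := by
    intro i j k l hij hik hjk hn
    rcases Nat.eq_zero_or_pos (A l).card with h0 | h0
    · exact H.mem_of_card_eq_zero (dvd_mul_left _ _) h0 _
    refine H.mem_of_distinct hij hik hjk ⟨Y j * Y k * Y l, by ring⟩ ⟨Y i * Y k * Y l, by ring⟩
      ⟨Y i * Y j * Y l, by ring⟩ ?_ hh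
    obtain ⟨k', l', hk1, hk2, hl1, hl2, hkl, hcases, hsum⟩ := sum_eq_of_ne hij
    rw [hsum] at hN
    have hk : k = k' ∨ k = l' := ((hcases k).resolve_left hik.symm).resolve_left hjk.symm
    have hdi := hd i
    have hdj := hd j
    have hdk := hd k'
    have hdl := hd l'
    rcases hk with rfl | rfl <;> rcases hcases l with rfl | rfl | rfl | rfl <;> omega
  have hperm : ∀ {M M' : S}, h ∈ xColon J M → M = M' → h ∈ xColon J M' := fun h e => e ▸ h
  by_cases hij : i = j
  · subst hij
    by_cases hik : i = k
    · subst hik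
      by_cases hil : i = l
      · subst hil
        exact hperm (h4 i (by omega)) (by ring)
      · exact hperm (h31 i l hil (by omega)) (by ring)
    · by_cases hil : i = l
      · subst hil
        exact hperm (h31 i k hik (by omega)) (by ring)
      · by_cases hkl : k = l
        · subst hkl
          exact hperm (h22 i k hik (by omega)) (by ring)
        · exact hperm (h3 i k l i hik hil hkl (by omega)) (by ring)
  · by_cases hik : i = k
    · subst hik
      by_cases hil : i = l
      · subst hil
        exact hperm (h31 i j hij (by omega)) (by ring)
      · by_cases hjl : j = l
        · subst hjl
          exact hperm (h22 i j hij (by omega)) (by ring)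
        · exact hperm (h3 i j l i hij hil hjl (by omega)) (by ring)
    · by_cases hjk : j = k
      · subst hjk
        by_cases hil : i = l
        · subst hil
          exact hperm (h22 i j hij (by omega)) (by ring)
        · by_cases hjl : j = l
          · subst hjl
            exact hperm (h31 j i (Ne.symm hij) (by omega)) (by ring)
          · exact hperm (h3 i j l j hij hil hjl (by omega)) (by ring)
      · exact h3 i j k l hij hik hjk (by omega)

end ContainsPartials

end BigradedRing

/-! ### Openness -/

namespace Zariski

/-- Let `G k v`, depending linearly on `v`, be weighted homogeneous polynomials. If for one `v` the
ideal generated by the `G k v` contains all weighted homogeneous polynomials of degree `D`, then so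
it does for general `v`: the degree `D` part is spanned by combinations of the `G k v` with
constant coefficient polynomials as long as a determinant is nonzero. -/
theorem forGeneral_span_of_exists {σ M κ V : Type*} [AddCommGroup M] [AddCommGroup V] [Module ℂ V]
    [Fintype κ] (w : σ → M) (D : M) [Module.Finite ℂ (weightedHomogeneousSubmodule ℂ w D)]
    (G : κ → V →ₗ[ℂ] MvPolynomial σ ℂ) (δ : κ → M)
    (hG : ∀ k v, (G k v).IsWeightedHomogeneous w (δ k)) {v₀ : V}
    (h₀ : ∀ h ∈ weightedHomogeneousSubmodule ℂ w D, h ∈ Ideal.span (Set.range fun k => G k v₀)) :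
    ForGeneral fun v => ∀ h ∈ weightedHomogeneousSubmodule ℂ w D,
      h ∈ Ideal.span (Set.range fun k => G k v) := by
  set H := weightedHomogeneousSubmodule ℂ w D with hH
  set b := Module.finBasis ℂ H with hb
  have hc : ∀ i, ∃ c : κ → MvPolynomial σ ℂ, ∑ k, c k * G k v₀ = b i := fun i =>
    Ideal.mem_span_range_iff_exists_fun.mp (h₀ (b i) (b i).2)
  choose c hc using hc
  -- The coefficients may be replaced by their homogeneous components of the right degrees.
  set c' : Fin (Module.finrank ℂ H) → κ → MvPolynomial σ ℂ := fun i k =>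
    weightedHomogeneousComponent w (D - δ k) (c i k) with hc'
  have hmem : ∀ i v, ∑ k, c' i k * G k v ∈ H := fun i v =>
    H.sum_mem fun k _ => by
      have := (weightedHomogeneousComponent_isWeightedHomogeneous (w := w) (D - δ k) (c i k)).mul
        (hG k v)
      rwa [sub_add_cancel] at this
  set u : Fin (Module.finrank ℂ H) → V →ₗ[ℂ] H := fun i =>
    LinearMap.codRestrict H (∑ k, LinearMap.mulLeft ℂ (c' i k) ∘ₗ G k) fun v => by
      simpa using hmem i v with hu
  have huv : ∀ i v, (u i v : MvPolynomial σ ℂ) = ∑ k, c' i k * G k v := fun i v => by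
    simp [hu]
  have hu₀ : (fun i => u i v₀) = b := by
    funext i
    refine Subtype.ext ?_
    rw [huv, ← IsWeightedHomogeneous.weightedHomogeneousComponent_same (b i).2, ← hc i, map_sum]
    refine Finset.sum_congr rfl fun k _ => ?_
    have := weightedHomogeneousComponent_mul_right w (hG k v₀) (c i k) (D - δ k)
    rw [sub_add_cancel] at this
    rw [this]
  set p : V → ℂ := fun v => b.det fun i => u i v with hp
  have hpoly : p ∈ polynomialFunctions V := by
    have hpe : p = ∑ τ : Equiv.Perm (Fin (Module.finrank ℂ H)), Equiv.Perm.sign τ •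
        ∏ i, ((b.coord (τ i) ∘ₗ u i : Module.Dual ℂ V) : V → ℂ) := by
      funext v
      simp [hp, Module.Basis.det_apply, Matrix.det_apply, Module.Basis.toMatrix_apply]
    rw [hpe]
    refine Subalgebra.sum_mem _ fun τ _ => ?_
    exact Subalgebra.zsmul_mem _ (Subalgebra.prod_mem _ fun i _ =>
      Algebra.subset_adjoin (Set.mem_range_self (b.coord (τ i) ∘ₗ u i))) _
  refine ⟨{v | p v ≠ 0}, ⟨{p}, by simpa using hpoly, by ext v; simp⟩, ⟨v₀, ?_⟩, ?_⟩
  · simp [hp, hu₀, Module.Basis.det_self]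
  · intro v hv h hh
    have hspan := ((Module.Basis.is_basis_iff_det b).mpr (isUnit_iff_ne_zero.mpr hv)).2
    have hle : (⊤ : Submodule ℂ H) ≤ Submodule.comap H.subtype
        ((Ideal.span (Set.range fun k => G k v)).restrictScalars ℂ) := by
      rw [← hspan, Submodule.span_le]
      rintro _ ⟨i, rfl⟩
      change (u i v : MvPolynomial σ ℂ) ∈ Ideal.span (Set.range fun k => G k v)
      rw [huv]
      exact Ideal.sum_mem _ fun k _ => Ideal.mul_mem_left _ _ (Ideal.subset_span ⟨k, rfl⟩)
    exact hle (x := (⟨h, hh⟩ : H)) trivial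

end Zariski

/-! ### The bigraded pieces -/

namespace BigradedRing
open TangentLines

lemma weight_mapDomain_inl (r : Fin 4 → ℕ) (β : Fin 3 →₀ ℕ) :
    Finsupp.weight (bidegree r) (β.mapDomain Sum.inl) = ((β.degree : ℤ), 0) := by
  induction β using Finsupp.induction_linear with
  | zero => simp [Prod.zero_eq_mk]
  | add f g hf hg => rw [Finsupp.mapDomain_add, map_add, hf, hg, map_add]; simp
  | single i n => simp [Finsupp.mapDomain_single, Finsupp.weight_single, bidegree]

lemma weight_mapDomain_inr_snd (r : Fin 4 → ℕ) (γ : Fin 4 →₀ ℕ) :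
    (Finsupp.weight (bidegree r) (γ.mapDomain Sum.inr)).2 = γ.degree := by
  induction γ using Finsupp.induction_linear with
  | zero => simp
  | add f g hf hg => rw [Finsupp.mapDomain_add, map_add, Prod.snd_add, hf, hg, map_add]; simp
  | single i n => simp [Finsupp.mapDomain_single, Finsupp.weight_single, bidegree]

/-- The spaces `S(m, n)` are finite-dimensional: they are contained in the homogeneous parts of a
grading with positive degrees of all variables. -/
lemma finite_homogeneousPart (r : Fin 4 → ℕ) (m n : ℤ) :
    Module.Finite ℂ (homogeneousPart r m n) := by
  set R := ∑ j, r j with hR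
  have hr : ∀ j, r j ≤ R := fun j => Finset.single_le_sum (fun _ _ => Nat.zero_le _)
    (Finset.mem_univ j)
  set w : Fin 3 ⊕ Fin 4 → ℕ := Sum.elim (fun _ => 1) (fun j => R + 1 - r j) with hw
  have hw0 : ∀ i, w i ≠ 0 := by
    rintro (k | j)
    · simp [hw]
    · have := hr j
      simp only [hw, Sum.elim_inr]
      omega
  have hweight : ∀ ν : Fin 3 ⊕ Fin 4 →₀ ℕ, (Finsupp.weight w ν : ℤ) =
      (Finsupp.weight (bidegree r) ν).1 + (R + 1) * (Finsupp.weight (bidegree r) ν).2 := by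
    intro ν
    induction ν using Finsupp.induction_linear with
    | zero => simp
    | add f g hf hg =>
      rw [map_add, map_add, Nat.cast_add, hf, hg, Prod.fst_add, Prod.snd_add]
      ring
    | single i a =>
      rw [Finsupp.weight_single, Finsupp.weight_single]
      rcases i with k | j
      · simp [hw, bidegree]
      · have := hr j
        simp only [hw, bidegree, Sum.elim_inr, smul_eq_mul, Prod.smul_mk, nsmul_eq_mul,
          Nat.cast_mul]
        rw [Nat.cast_sub (by omega)]
        push_cast
        ring
  have hle : homogeneousPart r m n ≤
      weightedHomogeneousSubmodule ℂ w (m + (R + 1) * n).toNat := by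
    intro p hp ν hν
    have h1 := hweight ν
    rw [hp hν] at h1
    dsimp only at h1
    omega
  have := Module.Finite.iff_fg.mpr
    (weightedHomogeneousSubmodule_fg (R := ℂ) w hw0 (m + (R + 1) * n).toNat)
  exact Submodule.finiteDimensional_of_le hle

lemma isWeightedHomogeneous_incl (r : Fin 4 → ℕ) {p : MvPolynomial (Fin 3) ℂ} {n : ℕ}
    (hp : p.IsHomogeneous n) : (incl p).IsWeightedHomogeneous (bidegree r) ((n : ℤ), 0) := by
  intro ν hν
  obtain ⟨β, rfl, hβ⟩ := coeff_rename_ne_zero _ _ _ hν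
  rw [weight_mapDomain_inl, ← hp hβ, Finsupp.degree_eq_weight_one]
  rfl

lemma incl_mul_Y_sq_mem (r : Fin 4 → ℕ) {p : MvPolynomial (Fin 3) ℂ} {n : ℕ}
    (hp : p.IsHomogeneous n) (i : Fin 4) {m : ℤ} (hm : (n : ℤ) = m + 2 * r i) :
    incl p * Y i ^ 2 ∈ homogeneousPart r m 2 := by
  have h := (isWeightedHomogeneous_incl r hp).mul
    ((isWeightedHomogeneous_X ℂ (bidegree r) (Sum.inr i)).pow 2)
  have hdeg : ((n : ℤ), (0 : ℤ)) + 2 • bidegree r (Sum.inr i) = (m, 2) := by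
    ext
    · simp [bidegree]; omega
    · simp [bidegree]
  rwa [hdeg] at h

lemma exists_eq_single_add {σ : Type*} {γ : σ →₀ ℕ} {n : ℕ} (h : γ.degree = n + 1) :
    ∃ i γ', γ = Finsupp.single i 1 + γ' ∧ γ'.degree = n := by
  classical
  have hne : γ ≠ 0 := by
    rintro rfl
    simp at h
  obtain ⟨i, hi⟩ := Finsupp.ne_iff.mp hne
  have hle : Finsupp.single i 1 ≤ γ := Finsupp.single_le_iff.mpr (Nat.one_le_iff_ne_zero.mpr hi)
  have hadd := add_tsub_cancel_of_le hle
  refine ⟨i, γ - Finsupp.single i 1, hadd.symm, ?_⟩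
  rw [← hadd, map_add, Finsupp.degree_single] at h
  omega

/-- `S(t, 4)` is spanned by the products of forms in `x₀, x₁, x₂` and four variables `y_i`. -/
lemma mem_of_forall_monomials {r : Fin 4 → ℕ} {m : ℤ} {J : Ideal S}
    (hJ : ∀ i j k l, ∀ n : ℕ, (n : ℤ) = m + r i + r j + r k + r l →
      ∀ h : MvPolynomial (Fin 3) ℂ, h.IsHomogeneous n → h ∈ xColon J (Y i * Y j * Y k * Y l))
    {h : S} (hh : h ∈ homogeneousPart r m 4) : h ∈ J := by
  rw [← support_sum_monomial_coeff h]
  refine J.sum_mem fun ν hν => ?_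
  have hw : Finsupp.weight (bidegree r) ν = (m, 4) := hh (mem_support_iff.mp hν)
  generalize coeff ν h = a
  set β : Fin 3 →₀ ℕ := ν.comapDomain Sum.inl Sum.inl_injective.injOn
  set γ : Fin 4 →₀ ℕ := ν.comapDomain Sum.inr Sum.inr_injective.injOn
  have hν : ν = β.mapDomain Sum.inl + γ.mapDomain Sum.inr := by
    ext (k | j)
    · rw [Finsupp.add_apply, Finsupp.mapDomain_apply Sum.inl_injective,
        Finsupp.mapDomain_of_notMem_range _ _ (by simp), add_zero]
      rfl
    · rw [Finsupp.add_apply, Finsupp.mapDomain_apply Sum.inr_injective,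
        Finsupp.mapDomain_of_notMem_range _ _ (by simp), zero_add]
      rfl
  rw [hν, map_add, weight_mapDomain_inl] at hw
  have hγ : γ.degree = 4 := by
    have := congrArg Prod.snd hw
    rw [Prod.snd_add, weight_mapDomain_inr_snd, zero_add] at this
    dsimp only at this
    exact_mod_cast this
  obtain ⟨i, γ₁, hγ₁, h₁⟩ := exists_eq_single_add hγ
  obtain ⟨j, γ₂, rfl, h₂⟩ := exists_eq_single_add h₁
  obtain ⟨k, γ₃, rfl, h₃⟩ := exists_eq_single_add h₂
  obtain ⟨l, γ₄, rfl, h₄⟩ := exists_eq_single_add h₃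
  rw [Finsupp.degree_eq_zero_iff] at h₄
  subst h₄
  have hdeg := congrArg Prod.fst hw
  rw [hγ₁] at hdeg
  simp only [Finsupp.mapDomain_add, Finsupp.mapDomain_single, map_add, Finsupp.weight_single,
    bidegree, Sum.elim_inr, Prod.fst_add, one_smul, Finsupp.mapDomain_zero, map_zero,
    Prod.fst_zero] at hdeg
  have hmem := mem_xColon.mp (hJ i j k l β.degree (by linarith) (monomial β a)
    (isHomogeneous_monomial a rfl))
  convert hmem using 1
  rw [hν, hγ₁, rename_monomial]
  simp only [Finsupp.mapDomain_add, Finsupp.mapDomain_single, X, monomial_mul, add_zero,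
    add_assoc, mul_one]

end BigradedRing

/-! ### The special pair -/

namespace BigradedRing
open TangentLines

/-- There are sets of lines of prescribed cardinalities whose parameters, coloured by the sets,
determine bidegree `< N - 2`. -/
lemma exists_lines {N : ℕ} (e : Fin 4 → ℕ) (he : ∑ i, e i = 2 * N) :
    ∃ (A : Fin 4 → Finset ℂ) (col : ℂ → Fin 4), (∀ i, (A i).card = e i) ∧
      (∀ i j, i ≠ j → Disjoint (A i) (A j)) ∧ (∀ i, ∀ c ∈ A i, col c = i) ∧
      BivariateInterpolation.MonochromaticDetermining col (Finset.univ.biUnion A) id (N - 2) := by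
  classical
  obtain ⟨c, hinj, hdet⟩ := BivariateInterpolation.exists_monochromaticDetermining
    (α := Σ i : Fin 4, Fin (e i)) Sigma.fst (N - 2) Finset.univ (by
      rw [Finset.card_univ, Fintype.card_sigma]
      simp only [Fintype.card_fin]
      omega)
  have hc : ∀ z w, c z = c w → z = w := fun z w h => hinj (by simp) (by simp) h
  set A : Fin 4 → Finset ℂ := fun i => Finset.univ.image fun k => c ⟨i, k⟩ with hA
  have hmem : ∀ z, c z ∈ A z.1 := fun z => Finset.mem_image.mpr ⟨z.2, Finset.mem_univ _, rfl⟩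
  have hcol : ∀ i, ∀ a ∈ A i, ∃ z, c z = a ∧ z.1 = i := fun i a ha => by
    obtain ⟨k, -, hk⟩ := Finset.mem_image.mp ha
    exact ⟨⟨i, k⟩, hk, rfl⟩
  set col : ℂ → Fin 4 := fun a => if h : ∃ z, c z = a then h.choose.1 else 0 with hcoldef
  have hcolc : ∀ z, col (c z) = z.1 := fun z => by
    have h : ∃ w, c w = c z := ⟨z, rfl⟩
    rw [hcoldef]
    dsimp only
    rw [dif_pos h, hc _ _ h.choose_spec]
  refine ⟨A, col, fun i => ?_, fun i j hij => ?_, fun i a ha => ?_, ?_⟩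
  · rw [hA]
    dsimp only
    rw [Finset.card_image_of_injective, Finset.card_univ, Fintype.card_fin]
    intro k l hkl
    simpa using hc _ _ hkl
  · rw [Finset.disjoint_left]
    intro a ha hb
    obtain ⟨z, rfl, rfl⟩ := hcol i a ha
    obtain ⟨w, hw, rfl⟩ := hcol j _ hb
    exact hij (by rw [hc _ _ hw])
  · obtain ⟨z, rfl, rfl⟩ := hcol i a ha
    exact hcolc z
  · intro F hF hzero
    refine hdet F hF fun z _ w _ hzw hfst => ?_
    have hZ : ∀ z, c z ∈ Finset.univ.biUnion A := fun z =>
      Finset.mem_biUnion.mpr ⟨z.1, Finset.mem_univ _, hmem z⟩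
    exact hzero (c z) (hZ z) (c w) (hZ w) (fun h => hzw (hc _ _ h)) (by rw [hcolc, hcolc, hfst])

/-- The polynomial `∑ i, a_i * y_i ^ 2`, where `a_i` is the equation of the union of the lines
in `A i`. -/
noncomputable def diagonalQuadric (A : Fin 4 → Finset ℂ) : S := ∑ i, incl (lines (A i)) * Y i ^ 2

lemma pderiv_inl_diagonalQuadric (A : Fin 4 → Finset ℂ) (k : Fin 3) :
    pderiv (Sum.inl k) (diagonalQuadric A) = ∑ j, incl (pderiv k (lines (A j))) * Y j ^ 2 := by
  rw [diagonalQuadric, map_sum]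
  refine Finset.sum_congr rfl fun j _ => ?_
  have h : pderiv (Sum.inl k) (Y j) = 0 := pderiv_X_of_ne (by simp)
  rw [pderiv_mul, pderiv_pow, h, mul_zero, mul_zero, add_zero, pderiv_rename Sum.inl_injective]

lemma pderiv_inr_diagonalQuadric (A : Fin 4 → Finset ℂ) (i : Fin 4) :
    pderiv (Sum.inr i) (diagonalQuadric A) = C 2 * (incl (lines (A i)) * Y i) := by
  have h : ∀ p, pderiv (Sum.inr i) (incl p) = 0 := fun p => by
    refine pderiv_eq_zero_of_notMem_vars fun hi => ?_
    obtain ⟨k, -, hk⟩ := Finset.mem_image.mp (vars_rename _ _ hi)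
    simp at hk
  rw [diagonalQuadric, map_sum, Finset.sum_eq_single i]
  · rw [pderiv_mul, pderiv_pow, h, pderiv_X_self]
    rw [map_ofNat C 2]
    simp
    ring
  · intro j _ hji
    have hj : pderiv (Sum.inr i) (Y j) = 0 := pderiv_X_of_ne (by simpa using hji)
    rw [pderiv_mul, pderiv_pow, h, hj]
    ring
  · exact fun hi => absurd (Finset.mem_univ i) hi

lemma containsPartials_jacobianIdealWith {A : Fin 4 → Finset ℂ}
    (hA : ∀ i j, i ≠ j → Disjoint (A i) (A j)) (g : S) :
    ContainsPartials A (jacobianIdealWith (diagonalQuadric A) g) where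
  disjoint := hA
  lines_mul_mem i := by
    have h : pderiv (Sum.inr i) (diagonalQuadric A) ∈
        jacobianIdealWith (diagonalQuadric A) g :=
      Ideal.subset_span (Or.inl ⟨Sum.inr i, rfl⟩)
    rw [pderiv_inr_diagonalQuadric] at h
    have h2 := Ideal.mul_mem_left _ (C (1 / 2)) h
    rwa [← mul_assoc, ← C_mul, one_div_mul_cancel two_ne_zero, C_1, one_mul] at h2
  sum_pderiv_mem k := by
    rw [← pderiv_inl_diagonalQuadric]
    exact Ideal.subset_span (Or.inl ⟨Sum.inl k, rfl⟩)

end BigradedRing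

theorem mainTheorem2 (d : ℕ) (r : Fin 4 → ℕ) :
    Zariski.ForGeneral
      (fun v : BigradedRing.homogeneousPart r d 2 ×
          BigradedRing.homogeneousPart r (BigradedRing.t d r - d) 2 =>
        ∀ h ∈ BigradedRing.homogeneousPart r (BigradedRing.t d r) 4,
          h ∈ BigradedRing.jacobianIdealWith (v.1 : BigradedRing.S) (v.2 : BigradedRing.S)) := by
  open BigradedRing in
  set N := 2 * d + ∑ i, r i with hNdef
  have hNsum : ∑ i, (d + 2 * r i) = 2 * N := by
    simp only [Finset.sum_add_distrib, ← Finset.mul_sum, Finset.sum_const, Finset.card_univ,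
      Fintype.card_fin, smul_eq_mul, hNdef]
    ring
  have ht : t d r = N + 2 * d - 3 := by
    simp only [t, hNdef]
    push_cast
    ring
  obtain ⟨A, col, hcard, hdisj, hcol, hgood⟩ := exists_lines (fun i => d + 2 * r i) hNsum
  have hN : ∑ i, (A i).card = 2 * N := by simpa only [hcard] using hNsum
  have hf : diagonalQuadric A ∈ homogeneousPart r d 2 :=
    Submodule.sum_mem _ fun i _ => incl_mul_Y_sq_mem r (TangentLines.isHomogeneous_lines _) i
      (by rw [hcard]; push_cast; ring)
  have hg : powerQuadric A N ∈ homogeneousPart r (t d r - d) 2 :=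
    Submodule.sum_mem _ fun i hi => incl_mul_Y_sq_mem r (isHomogeneous_X_pow 2 _) i (by
      have h2 := (Finset.mem_filter.mp hi).2
      have hle : (A i).card ≤ 2 * N :=
        hN ▸ Finset.single_le_sum (f := fun i => (A i).card) (fun _ _ => Nat.zero_le _)
          (Finset.mem_univ i)
      have := hcard i
      rw [ht]
      omega)
  set G : Option (Fin 3 ⊕ Fin 4) →
      (homogeneousPart r d 2 × homogeneousPart r (t d r - d) 2) →ₗ[ℂ] S := fun k =>
    k.elim ((homogeneousPart r (t d r - d) 2).subtype ∘ₗ LinearMap.snd ℂ _ _)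
      fun i => (pderiv i).toLinearMap ∘ₗ (homogeneousPart r d 2).subtype ∘ₗ
        LinearMap.fst ℂ _ _ with hG
  have hspan : ∀ v, Ideal.span (Set.range fun k => G k v) =
      jacobianIdealWith (v.1 : S) (v.2 : S) := fun v => by
    rw [jacobianIdealWith]
    congr 1
    ext p
    simp only [Set.mem_range, Option.exists, Set.union_singleton, Set.mem_insert_iff,
      eq_comm (b := p), hG]
    rfl
  have : Module.Finite ℂ (weightedHomogeneousSubmodule ℂ (bidegree r) (t d r, 4)) :=
    finite_homogeneousPart r (t d r) 4
  have hmain := Zariski.forGeneral_span_of_exists (bidegree r) (t d r, 4)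
    G (fun k => k.elim (t d r - d, 2) fun i => ((d : ℤ), 2) - bidegree r i) (by
      rintro (_ | i) v
      · exact v.2.2
      · exact IsWeightedHomogeneous.pderiv v.1.2 (sub_add_cancel _ _))
    (v₀ := (⟨_, hf⟩, ⟨_, hg⟩)) (by
      intro h hh
      rw [hspan]
      refine mem_of_forall_monomials (r := r) (m := t d r) (fun i j k l n hn p hp => ?_) hh
      refine (containsPartials_jacobianIdealWith hdisj _).mem_of_isHomogeneous hcard hN hcol hgood
        (Ideal.subset_span (Or.inr rfl)) i j k l ?_ hp
      rw [ht] at hn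
      simp only [hcard]
      omega)
  simp only [hspan] at hmain
  exact hmain
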